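/- Notation. For a finite group $G$ and $g\in G$ let $D_G(g)=\{x\in G : xgx^{-1}\in\{g,g^{-1}\}\}$. For a prime $p$, an element $g\in G$ is called dihedral $p$-critical in $G$ if it has order $p$ and (i) $D_G(g)\neq G$; (ii) $D_H(g)=H$ for every proper subgroup $H$ of $G$ containing $g$; (iii) $D_{G/N}(gN)=G/N$ for every nontrivial normal subgroup $N$ of $G$. For $g\in G$ of order $n$ put $\hat g=1+g+\dots+g^{n-1}\in\mathbb{Z}G$; for positive integers $k,m$ with $k^m\equiv 1 \pmod n$ the Bass unit $u_{k,m}(g)$ is the unit $(1+g+\dots+g^{k-1})^m+\frac{1-k^m}{n}\,\hat g$ of $\mathbb{Z}G$. For $g,h\in G$ write $g^h=h^{-1}gh$. Theorem 3. Let $q\neq 5$ be an odd prime power, $G=\mathrm{PSL}(2,q)$, $p$ a prime, $a$ a dihedral $p$-critical element of $G$, and $u=u_{k,m}(a)$ a Bass unit of infinite order. Then $a$ is contained in a cyclic subgroup $\langle g\rangle$ of $G$ of order $\frac{q+1}{2}$. For any such $g$, consider the natural action of $G$ on the projective line over the field with $q$ elements. The group $\langle g\rangle$ has exactly two orbits $O_0,O_1$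 on it (labelled in either way), and each $O_i$ contains exactly $d=\frac{q+1}{2p}$ orbits $O_{i1},\dots,O_{id}$ of $\langle a\rangle$ ($i=0,1$). Let $h\in G\setminus D_G(a)$ and let $v=1+(1-g^h)\,h\,\widehat{g^h}$, i.e. $v=1+(1-g^h)h\left(1+g^h+\dots+(g^h)^{\frac{q+1}{2}-1}\right)$, which is a unit of $\mathbb{Z}G$. If $$\sum_{j=1}^d |h(O_{0j})\cap O_0|\,|O_{0j}\cap g^h(O_1)|\;\neq\;\sum_{j=1}^d |h(O_{1j})\cap O_0|\,|O_{1j}\cap g^h(O_0)|,$$ then there is a positive integer $n$ such that the group $\langle u^n,v^n\rangle$ is a non-abelian free group. -/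

import Mathlib

open scoped Pointwise LinearAlgebra.Projectivization

/-! ### Dihedralizers and dihedral critical elements -/

section Dihedral

variable {G : Type*} [Group G]

/-- The dihedralizer `D_G(g) = {x ∈ G : x g x⁻¹ ∈ {g, g⁻¹}}`. -/
def dihedralizer (g : G) : Set G :=
  {x | x * g * x⁻¹ = g ∨ x * g * x⁻¹ = g⁻¹}

/-- `g` is dihedral `p`-critical in `G` (here `p` is meant to be a prime). -/
structure IsDihedralCritical (p : ℕ) (g : G) : Prop where
  orderOf_eq : orderOf g = p
  ne_univ : dihedralizer g ≠ Set.univ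
  subgroup_eq : ∀ (H : Subgroup G) (hg : g ∈ H), H ≠ ⊤ →
    dihedralizer (⟨g, hg⟩ : H) = Set.univ
  quotient_eq : ∀ (N : Subgroup G) [N.Normal], N ≠ ⊥ →
    dihedralizer (QuotientGroup.mk g : G ⧸ N) = Set.univ

end Dihedral

/-! ### Bass units and bicyclic units of the integral group ring -/

section GroupRing

variable {G : Type*} [Group G]

/-- The element `1 + g + ⋯ + g ^ (k - 1)` of `ℤG`. -/
noncomputable def powSum (k : ℕ) (g : G) : MonoidAlgebra ℤ G :=
  ∑ i ∈ Finset.range k, MonoidAlgebra.of ℤ G g ^ i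

/-- The element `ĝ = 1 + g + ⋯ + g ^ (n - 1)` of `ℤG`, where `n` is the order of `g`. -/
noncomputable def hatSum (g : G) : MonoidAlgebra ℤ G :=
  powSum (orderOf g) g

/-- The element
`(1 + g + ⋯ + g ^ (k - 1)) ^ m + ((1 - k ^ m) / n) (1 + g + ⋯ + g ^ (n - 1))` of `ℤG`,
where `n` is the order of `g`. The division is exact when `k ^ m ≡ 1` modulo `n`. -/
noncomputable def bassElement (k m : ℕ) (g : G) : MonoidAlgebra ℤ G :=
  powSum k g ^ m + ((1 - (k : ℤ) ^ m) / (orderOf g : ℤ)) • hatSum g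

/-- The element `1 + (1 - g) h ĝ` of `ℤG`. -/
noncomputable def bicyclicElement (g h : G) : MonoidAlgebra ℤ G :=
  1 + (1 - MonoidAlgebra.of ℤ G g) * MonoidAlgebra.of ℤ G h * hatSum g

theorem of_mul_hatSum (g : G) : MonoidAlgebra.of ℤ G g * hatSum g = hatSum g := by
  have h := mul_geom_sum (MonoidAlgebra.of ℤ G g) (orderOf g)
  rw [← map_pow, pow_orderOf_eq_one, map_one, sub_self, sub_mul, one_mul, sub_eq_zero] at h
  exact h

theorem hatSum_mul_of (g : G) : hatSum g * MonoidAlgebra.of ℤ G g = hatSum g := by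
  have h := geom_sum_mul (MonoidAlgebra.of ℤ G g) (orderOf g)
  rw [← map_pow, pow_orderOf_eq_one, map_one, sub_self, mul_sub, mul_one, sub_eq_zero] at h
  exact h

theorem of_pow_mul_hatSum (g : G) (i : ℕ) :
    MonoidAlgebra.of ℤ G g ^ i * hatSum g = hatSum g := by
  induction i with
  | zero => simp
  | succ i ih => rw [pow_succ, mul_assoc, of_mul_hatSum, ih]

/-- The sum `1 + x + ⋯ + x ^ (k - 1)` for `x = g ^ j`. -/
theorem powSum_pow_mul_hatSum (k j : ℕ) (g : G) :
    powSum k (g ^ j) * hatSum g = (k : ℤ) • hatSum g := by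
  simp only [powSum, Finset.sum_mul, map_pow, ← pow_mul, of_pow_mul_hatSum]
  simp

theorem powSum_mul_powSum (k l : ℕ) (g : G) :
    powSum k g * powSum l (g ^ k) = powSum (k * l) g := by
  simp only [powSum, map_pow]
  induction l with
  | zero => simp
  | succ l ih =>
    rw [Finset.sum_range_succ, mul_add, ih, Nat.mul_succ, Finset.sum_range_add, Finset.sum_mul]
    congr 1
    refine Finset.sum_congr rfl fun i _ => ?_
    rw [← pow_mul, ← pow_add, add_comm]

theorem powSum_one_add (c : ℕ) (g : G) :
    powSum (1 + orderOf g * c) g = 1 + (c : ℤ) • hatSum g := by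
  have key : ∀ c : ℕ, powSum (orderOf g * c) g = (c : ℤ) • hatSum g := by
    intro c
    rw [← powSum_mul_powSum, pow_orderOf_eq_one]
    have h0 : powSum c (1 : G) = ((c : ℤ) : MonoidAlgebra ℤ G) := by
      simp only [powSum, map_one, one_pow, Finset.sum_const, Finset.card_range, nsmul_eq_mul,
        mul_one, Int.cast_natCast]
    rw [h0, zsmul_eq_mul]
    exact (Int.cast_commute (c : ℤ) (powSum (orderOf g) g)).eq.symm
  have h1 : powSum (1 + orderOf g * c) g =
      1 + MonoidAlgebra.of ℤ G g * powSum (orderOf g * c) g := by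
    simp only [powSum]
    rw [Finset.sum_range_add, Finset.mul_sum, Finset.sum_range_one, pow_zero]
    simp only [pow_add, pow_one]
  rw [h1, key, mul_smul_comm, of_mul_hatSum]

theorem commute_powSum (k l i j : ℕ) (g : G) :
    Commute (powSum k (g ^ i)) (powSum l (g ^ j)) := by
  refine Commute.sum_left _ _ _ fun a _ => Commute.sum_right _ _ _ fun b _ => ?_
  rw [map_pow, map_pow]
  exact (((Commute.refl _).pow_pow i j).pow_pow a b)

theorem powSum_pow_pow_mul_hatSum (k j m : ℕ) (g : G) :
    powSum k (g ^ j) ^ m * hatSum g = ((k : ℤ) ^ m) • hatSum g := by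
  induction m with
  | zero => simp
  | succ m ih =>
    rw [pow_succ, mul_assoc, powSum_pow_mul_hatSum, mul_smul_comm, ih, smul_smul]
    congr 1
    ring

theorem hatSum_mul_hatSum (g : G) : hatSum g * hatSum g = (orderOf g : ℤ) • hatSum g := by
  have h := powSum_pow_mul_hatSum (orderOf g) 1 g
  rwa [pow_one] at h

theorem one_add_smul_hatSum_pow (c : ℤ) (m : ℕ) (g : G) :
    ∃ f : ℤ, (1 + c • hatSum g) ^ m = 1 + f • hatSum g ∧
      (orderOf g : ℤ) * f = (1 + c * orderOf g) ^ m - 1 := by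
  induction m with
  | zero => exact ⟨0, by simp, by simp⟩
  | succ m ih =>
    obtain ⟨f, hf, hf'⟩ := ih
    refine ⟨f + c + f * c * orderOf g, ?_, ?_⟩
    · rw [pow_succ, hf, add_mul, mul_add, mul_add, smul_mul_smul_comm, hatSum_mul_hatSum,
        smul_smul, one_mul, one_mul, mul_one, add_smul, add_smul]
      abel
    · rw [pow_succ]
      linear_combination (1 + c * orderOf g) * hf'

/-- The inverse of the Bass element on `g` is a Bass element on `g ^ k`. -/
theorem bassElement_inverse [Finite G] {k m : ℕ} {g : G} (hm : 0 < m)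
    (hk : k ^ m ≡ 1 [MOD orderOf g]) :
    bassElement k m g * (powSum (k ^ (m - 1)) (g ^ k) ^ m +
        ((1 - ((k ^ (m - 1) : ℕ) : ℤ) ^ m) / (orderOf g : ℤ)) • hatSum g) = 1 ∧
      (powSum (k ^ (m - 1)) (g ^ k) ^ m +
        ((1 - ((k ^ (m - 1) : ℕ) : ℤ) ^ m) / (orderOf g : ℤ)) • hatSum g) *
        bassElement k m g = 1 := by
  have hn : (orderOf g : ℤ) ≠ 0 := by
    exact_mod_cast (orderOf_pos g).ne'
  have hkz : (orderOf g : ℤ) ∣ 1 - (k : ℤ) ^ m := by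
    have := (Nat.modEq_iff_dvd).1 hk
    simpa using this
  obtain ⟨c, hc⟩ := hkz
  set l : ℕ := k ^ (m - 1) with hl
  have hkl : k * l = k ^ m := by rw [hl, ← pow_succ', Nat.sub_add_cancel hm]
  have hlz : (orderOf g : ℤ) ∣ 1 - (l : ℤ) ^ m := by
    have h1 : (l : ℤ) ^ m = ((k : ℤ) ^ m) ^ (m - 1) := by
      rw [hl]; push_cast; rw [← pow_mul, ← pow_mul, mul_comm]
    rw [h1]
    have h2 := sub_one_dvd_pow_sub_one ((k : ℤ) ^ m) (m - 1)
    have h3 : (orderOf g : ℤ) ∣ (k : ℤ) ^ m - 1 := ⟨-c, by linear_combination -hc⟩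
    have h4 := h3.trans h2
    rw [← neg_sub]
    exact (dvd_neg).2 h4
  obtain ⟨e, he⟩ := hlz
  have hst : powSum k g * powSum l (g ^ k) = 1 + (-c) • hatSum g := by
    rw [powSum_mul_powSum, hkl]
    by_cases hk0 : k = 0
    · subst hk0
      have h1 : (orderOf g : ℤ) * c = 1 := by
        rw [← hc]; simp [hm.ne']
      have h2 : orderOf g = 1 := by
        have := Int.eq_one_or_neg_one_of_mul_eq_one h1
        omega
      have h3 : c = 1 := by rw [h2] at h1; simpa using h1
      have h4 : hatSum g = 1 := by
        rw [hatSum, h2, powSum, Finset.sum_range_one, pow_zero]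
      rw [zero_pow hm.ne', h3, h4, powSum, Finset.sum_range_zero, neg_smul, one_smul,
        add_neg_cancel]
    · have hpos : 1 ≤ k ^ m := Nat.one_le_pow _ _ (Nat.pos_of_ne_zero hk0)
      obtain ⟨b, hb⟩ := (Nat.modEq_iff_dvd' hpos).1 hk.symm
      have hb' : k ^ m = 1 + orderOf g * b := by omega
      have hbc : (b : ℤ) = -c := by
        apply mul_left_cancel₀ hn
        have : (k : ℤ) ^ m = 1 + orderOf g * b := by exact_mod_cast hb'
        linear_combination -this + -hc
      rw [hb', powSum_one_add, hbc]
  have hcomm : Commute (powSum k g) (powSum l (g ^ k)) := by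
    simpa using commute_powSum k l 1 k g
  have hsN : Commute (powSum k g) (hatSum g) := by
    simpa [hatSum] using commute_powSum k (orderOf g) 1 1 g
  have htN : Commute (powSum l (g ^ k)) (hatSum g) := by
    simpa [hatSum] using commute_powSum l (orderOf g) k 1 g
  have hu : bassElement k m g = powSum k g ^ m + c • hatSum g := by
    rw [bassElement, hc, Int.mul_ediv_cancel_left _ hn]
  rw [he, Int.mul_ediv_cancel_left _ hn, hu]
  have hC : Commute (powSum k g ^ m + c • hatSum g)
      (powSum l (g ^ k) ^ m + e • hatSum g) :=
    Commute.add_left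
      ((hcomm.pow_pow m m).add_right ((hsN.pow_left m).smul_right e))
      (((htN.symm.pow_right m).smul_left c).add_right
        (((Commute.refl _).smul_left c).smul_right e))
  have hmain : (powSum k g ^ m + c • hatSum g) *
      (powSum l (g ^ k) ^ m + e • hatSum g) = 1 := by
    obtain ⟨f, hf, hf'⟩ := one_add_smul_hatSum_pow (-c) m g
    have hs := powSum_pow_pow_mul_hatSum k 1 m g
    rw [pow_one] at hs
    have ht := powSum_pow_pow_mul_hatSum l k m g
    have ht' : hatSum g * powSum l (g ^ k) ^ m = ((l : ℤ) ^ m) • hatSum g := by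
      rw [← (htN.pow_left m).eq, ht]
    rw [add_mul, mul_add, mul_add, ← hcomm.mul_pow, hst, hf, mul_smul_comm, hs,
      smul_mul_assoc, ht', smul_mul_smul_comm, hatSum_mul_hatSum,
      smul_smul, smul_smul, smul_smul, ← add_smul, add_assoc, add_assoc, ← add_smul, ← add_smul]
    have : f + (e * (k : ℤ) ^ m + (c * (l : ℤ) ^ m + c * e * orderOf g)) = 0 := by
      apply mul_left_cancel₀ hn
      have h5 : (1 + -c * (orderOf g : ℤ)) = (k : ℤ) ^ m := by linear_combination hc
      rw [h5, ← mul_pow_sub_one hm.ne' ((k : ℤ) ^ m)] at hf'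
      have h6 : (l : ℤ) ^ m = ((k : ℤ) ^ m) ^ (m - 1) := by
        rw [hl]; push_cast; rw [← pow_mul, ← pow_mul, mul_comm]
      rw [← h6] at hf'
      linear_combination hf' - he - (l : ℤ) ^ m * hc - (orderOf g : ℤ) * e * hc
    rw [this, zero_smul, add_zero]
  exact ⟨hmain, hC.eq ▸ hmain⟩

/-- The Bass unit `u_{k,m}(g)`. -/
noncomputable def bassUnit [Finite G] (k m : ℕ) (g : G) (hm : 0 < m)
    (hk : k ^ m ≡ 1 [MOD orderOf g]) : (MonoidAlgebra ℤ G)ˣ where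
  val := bassElement k m g
  inv := powSum (k ^ (m - 1)) (g ^ k) ^ m +
    ((1 - ((k ^ (m - 1) : ℕ) : ℤ) ^ m) / (orderOf g : ℤ)) • hatSum g
  val_inv := (bassElement_inverse hm hk).1
  inv_val := (bassElement_inverse hm hk).2

theorem bicyclic_nilpotent (g h : G) :
    ((1 - MonoidAlgebra.of ℤ G g) * MonoidAlgebra.of ℤ G h * hatSum g) *
      ((1 - MonoidAlgebra.of ℤ G g) * MonoidAlgebra.of ℤ G h * hatSum g) = 0 := by
  have h0 : hatSum g * (1 - MonoidAlgebra.of ℤ G g) = 0 := by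
    rw [mul_sub, mul_one, hatSum_mul_of, sub_self]
  rw [mul_assoc _ (hatSum g), ← mul_assoc (hatSum g), ← mul_assoc (hatSum g), h0,
    zero_mul, zero_mul, mul_zero]

/-- The bicyclic unit `1 + (1 - g) h ĝ`. -/
noncomputable def bicyclicUnit (g h : G) : (MonoidAlgebra ℤ G)ˣ where
  val := bicyclicElement g h
  inv := 1 - (1 - MonoidAlgebra.of ℤ G g) * MonoidAlgebra.of ℤ G h * hatSum g
  val_inv := by
    rw [bicyclicElement, add_mul, one_mul, mul_sub, mul_one, bicyclic_nilpotent, sub_zero,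
      sub_add_cancel]
  inv_val := by
    rw [bicyclicElement, mul_add, mul_one, sub_mul 1 _ (_ * hatSum g), one_mul, bicyclic_nilpotent, sub_zero,
      sub_add_cancel]

end GroupRing

/-! ### Free groups and orbits -/

/-- The subgroup generated by `x` and `y` is a non-abelian free group. -/
def GeneratesNonabelianFree {U : Type*} [Group U] (x y : U) : Prop :=
  IsFreeGroup (Subgroup.closure {x, y}) ∧ ¬ IsMulCommutative (Subgroup.closure {x, y})

/-- The set of orbits of the cyclic group `⟨x⟩` on `X`. -/
def cyclicOrbits {G : Type*} [Group G] (X : Type*) [MulAction G X] (x : G) : Set (Set X) :=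
  Set.range fun y : X => MulAction.orbit (Subgroup.zpowers x) y

/-- The set of orbits of `⟨x⟩` that are contained in `O`. -/
def cyclicOrbitsIn {G : Type*} [Group G] {X : Type*} [MulAction G X] (x : G) (O : Set X) :
    Set (Set X) :=
  {T ∈ cyclicOrbits X x | T ⊆ O}

/-- `PSL(2, F)`. -/
abbrev PSL2 (F : Type*) [Field F] : Type _ :=
  Matrix.ProjectiveSpecialLinearGroup (Fin 2) F

/-- The projective line over `F`. -/
abbrev ProjLine (F : Type*) [Field F] : Type _ :=
  ℙ F (Fin 2 → F)

/-!
The group `G = PSL(2, q)` acts on the complex-valued functions on the projective line. If `g` has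
order `(q + 1) / 2` and acts freely with the two orbits `O₀` and `O₁`, then the bicyclic unit on
`g ^ h = h⁻¹ g h` and `h`
acts as a transvection `w ↦ w + φ w • α`, where `α = 1_{O₀} - 1_{g ^ h O₀}` and
`φ w = w (h⁻¹ O₀) - w (h⁻¹ O₁)` (`permRep_bicyclicElement`). The Bass unit `u` is a polynomial in
`a`, so it is diagonalized by the spectral projections of `a`, with eigenvalue
`((ζ ^ k - 1) / (ζ - 1)) ^ m` at a root of unity `ζ ≠ 1` of order `p`.

Two facts make powers of `u` and of the transvection play ping-pong.

* The largest and the smallest absolute value of an eigenvalue of `u` are each attained at exactly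
  one pair `ζ, ζ⁻¹` of roots of unity (`norm_bassEigenvalue_lt`, `lt_norm_bassEigenvalue`). This is
  an inequality between chords of a regular polygon (`chord_mul_mul_chord_one_lt`). The eigenvalues
  of `u ^ p` at `ζ` and `ζ⁻¹` agree.
* The component of `α` in the sum of the eigenspaces of `ζ` and `ζ⁻¹` is not killed by `φ`, for any
  `ζ ≠ 1` (`spectralProj_add_spectralProj_neg_ne_zero`). By rationality, vanishing for one `ζ` means
  that the integers `φ (a ^ i α) + φ (a ^ (-i) α)` do not depend on `i`, hence are all zero, as
  `φ α = 0`. The sum of the integers `φ (a ^ i α)` is twice the difference of the two orbit sums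
  in the hypothesis (`sum_coefficients_eq`), so it is not zero.

Hence `φ (u ^ N α)` is, up to a constant, as large as the norm of `u ^ N` when `N → ± ∞`, and
`exists_pow_generatesNonabelianFree` applies.

The structure of `PSL(2, q)` enters as follows. A Bass unit of infinite order has `k ≠ ± 1` modulo
`p` (`isOfFinOrder_bassUnit`), so `p ≥ 5`. Criticality in point stabilizers then shows that `a` has
no fixed point on the projective line (`IsDihedralCritical.smul_ne`), so `a` lies in a non-split
torus (`exists_orderOf_eq_and_mem_zpowers`). A cyclic group containing `a` acts freely, because a
projective transformation with three fixed points is trivial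
(`eq_one_of_mem_zpowers_of_smul_eq`, `eq_one_of_smul_eq_three`).
-/

/-! ### Ping-pong for a dominated operator and a transvection -/

/-- If the homomorphism from the free product of two infinite cyclic groups that sends the
generators to `x` and `y` is injective, then `x` and `y` generate a non-abelian free group. -/
theorem generatesNonabelianFree_of_injective {U : Type*} [Group U] (x y : U)
    (h : Function.Injective (Monoid.CoprodI.lift fun i : Bool =>
      (FreeGroup.lift fun _ : Unit => cond i x y : FreeGroup Unit →* U))) :
    GeneratesNonabelianFree x y := by
  set f : Monoid.CoprodI (fun _ : Bool => FreeGroup Unit) →* U :=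
    Monoid.CoprodI.lift fun i : Bool =>
      (FreeGroup.lift fun _ : Unit => cond i x y : FreeGroup Unit →* U) with hf
  have hx : f (Monoid.CoprodI.of (i := true) (FreeGroup.of ())) = x := by simp [hf]
  have hy : f (Monoid.CoprodI.of (i := false) (FreeGroup.of ())) = y := by simp [hf]
  have hrange : f.range = Subgroup.closure {x, y} := by
    apply le_antisymm
    · rw [hf, Monoid.CoprodI.range_eq_iSup]
      refine iSup_le fun i => ?_
      rw [FreeGroup.range_lift_eq_closure, Subgroup.closure_le]
      rintro _ ⟨_, rfl⟩
      cases i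
      · exact Subgroup.subset_closure (by simp)
      · exact Subgroup.subset_closure (by simp)
    · rw [Subgroup.closure_le]
      rintro z (rfl | rfl)
      · exact ⟨_, hx⟩
      · exact ⟨_, hy⟩
  refine ⟨?_, fun hc => ?_⟩
  · rw [← hrange]
    exact IsFreeGroup.ofMulEquiv (MonoidHom.ofInjective h)
  · have hxy : x * y = y * x := by
      have := hc.is_comm.comm ⟨x, Subgroup.subset_closure (by simp)⟩
        ⟨y, Subgroup.subset_closure (by simp)⟩
      exact congrArg Subtype.val this
    rw [← hx, ← hy, ← map_mul, ← map_mul] at hxy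
    have h1 := h hxy
    -- two transpositions in `S₃` that do not commute separate the two words
    have h2 := congrArg (Monoid.CoprodI.lift fun i : Bool =>
      (FreeGroup.lift fun _ : Unit => cond i (Equiv.swap 0 1) (Equiv.swap 1 2) :
        FreeGroup Unit →* Equiv.Perm (Fin 3))) h1
    simp only [map_mul, Monoid.CoprodI.lift_of, FreeGroup.lift_apply_of, cond_true,
      cond_false] at h2
    exact absurd h2 (by decide)

/-- Ping-pong for a pair `x`, `y` where `y` acts as the transvection `w ↦ w + φ w • α`, the powers
`x ^ N` have norm at most a multiple of `R N`, and `φ (x ^ N α)` is at least of order `R N` when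
`|N|` is large. The two ping-pong sets are a narrow cone around the line of `α` and the set of
vectors on which `φ` is not small. -/
theorem exists_pow_generatesNonabelianFree {U V : Type*} [Group U] [NormedAddCommGroup V]
    [NormedSpace ℂ V] (ρ : U →* Module.End ℂ V) (x y : U) (φ : V →ₗ[ℂ] ℂ) (α : V) {D C c : ℝ}
    (hD0 : 0 < D) (hC0 : 0 < C) (hc : 0 < c) (hD : ∀ w, ‖φ w‖ ≤ D * ‖w‖) (hα : φ α = 0)
    (hy : ∀ w, ρ y w = w + φ w • α) (R : ℤ → ℝ) (hR : ∀ N, 0 < R N)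
    (hC : ∀ N w, ‖ρ (x ^ N) w‖ ≤ C * R N * ‖w‖) (N₀ : ℕ)
    (hN : ∀ N : ℤ, (N₀ : ℤ) ≤ |N| → c * R N ≤ ‖φ (ρ (x ^ N) α)‖) :
    ∃ n : ℕ, 0 < n ∧ GeneratesNonabelianFree (x ^ n) (y ^ n) := by
  have hα0 : 0 < ‖α‖ := by
    rw [norm_pos_iff]
    rintro rfl
    have h1 := hN N₀ (le_abs_self _)
    rw [map_zero, map_zero, norm_zero] at h1
    have h2 := mul_pos hc (hR N₀)
    linarith
  have hyz : ∀ (b : ℤ) w, ρ (y ^ b) w = w + ((b : ℂ) * φ w) • α := by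
    have hyn : ∀ (b : ℕ) w, ρ (y ^ b) w = w + ((b : ℂ) * φ w) • α := by
      intro b
      induction b with
      | zero => intro w; simp
      | succ b ih =>
        intro w
        rw [pow_succ', map_mul, Module.End.mul_apply, ih, hy, map_add, map_smul, hα, smul_zero,
          add_zero, add_assoc, ← add_smul]
        congr 2
        push_cast
        ring
    intro b w
    obtain ⟨b, rfl | rfl⟩ := b.eq_nat_or_neg
    · simpa using hyn b w
    · have h1 : ρ (y ^ b) (w + (((-(b : ℤ) : ℤ) : ℂ) * φ w) • α) = w := by
        rw [hyn, map_add, map_smul, hα, smul_zero, add_zero, add_assoc, ← add_smul]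
        push_cast
        simp
      rw [zpow_neg, zpow_natCast]
      conv_lhs => rw [← h1]
      rw [← Module.End.mul_apply, ← map_mul, inv_mul_cancel, map_one, Module.End.one_apply]
  set δ : ℝ := c / (2 * C * (‖α‖ + 1)) with hδ
  have hδ0 : 0 < δ := by positivity
  obtain ⟨η, hη0, hη1, hη2, hη3, hη4⟩ : ∃ η : ℝ, 0 < η ∧ η ≤ 1 ∧ D * C * η ≤ c / 2 ∧
      η ≤ ‖α‖ / 2 ∧ D * η < δ * (‖α‖ / 2) := by
    refine ⟨min (min 1 (c / 2 / (D * C))) (min (‖α‖ / 2) (δ * (‖α‖ / 2) / (2 * D))), ?_, ?_, ?_,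
      ?_, ?_⟩
    · positivity
    · exact (min_le_left _ _).trans (min_le_left _ _)
    · have := (min_le_left (min 1 (c / 2 / (D * C)))
        (min (‖α‖ / 2) (δ * (‖α‖ / 2) / (2 * D)))).trans (min_le_right _ _)
      rwa [le_div_iff₀' (by positivity)] at this
    · exact (min_le_right _ _).trans (min_le_left _ _)
    · have := (min_le_right (min 1 (c / 2 / (D * C)))
        (min (‖α‖ / 2) (δ * (‖α‖ / 2) / (2 * D)))).trans (min_le_right _ _)
      rw [le_div_iff₀' (by positivity)] at this
      have h2 : 0 < δ * (‖α‖ / 2) := by positivity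
      linarith
  obtain ⟨n, hn⟩ := exists_nat_gt (max (N₀ : ℝ) (1 / (δ * η)))
  have hnN : N₀ < n := by exact_mod_cast (le_max_left _ _).trans_lt hn
  have hn0 : 0 < n := by omega
  have hnη : 1 < n * (δ * η) := by
    have := (le_max_right _ _).trans_lt hn
    rwa [div_lt_iff₀ (by positivity)] at this
  refine ⟨n, hn0, generatesNonabelianFree_of_injective _ _ ?_⟩
  let : MulAction U V := MulAction.compHom V ρ
  have hsmul : ∀ (g : U) (w : V), g • w = ρ g w := fun _ _ => rfl
  let S : Bool → Set V := fun i =>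
    cond i {w | w ≠ 0 ∧ δ * ‖w‖ ≤ ‖φ w‖} {w | ∃ t : ℂ, t ≠ 0 ∧ ‖w - t • α‖ < η * ‖t‖}
  have hdisj : Disjoint (S true) (S false) := by
    rw [Set.disjoint_left]
    rintro w ⟨hw0, hw⟩ ⟨t, ht0, ht⟩
    have ht' : 0 < ‖t‖ := norm_pos_iff.2 ht0
    have h1 : ‖φ w‖ ≤ D * (η * ‖t‖) := by
      have : φ w = φ (w - t • α) := by rw [map_sub, map_smul, hα, smul_zero, sub_zero]
      rw [this]
      exact (hD _).trans (by gcongr)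
    have h2 : ‖t‖ * (‖α‖ / 2) ≤ ‖w‖ := by
      have h3 : ‖t • α‖ ≤ ‖w‖ + ‖w - t • α‖ := by
        have := norm_sub_le w (w - t • α)
        simpa using this
      rw [norm_smul] at h3
      nlinarith
    have h4 : δ * (‖t‖ * (‖α‖ / 2)) ≤ δ * ‖w‖ := by gcongr
    nlinarith
  refine Monoid.CoprodI.lift_injective_of_ping_pong _ ?_ S ?_ ?_ ?_
  · right
    refine ⟨true, ?_⟩
    rw [FreeGroup.freeGroupUnitEquivInt.cardinal_eq, Cardinal.mk_denumerable]
    exact Cardinal.natCast_le_aleph0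
  · rintro (_ | _)
    · exact ⟨α, 1, one_ne_zero, by simpa using hη0⟩
    · have h1 : 0 < ‖φ (ρ (x ^ (N₀ : ℤ)) α)‖ :=
        (mul_pos hc (hR N₀)).trans_le (hN N₀ (le_abs_self _))
      refine ⟨ρ (x ^ (N₀ : ℤ)) α, ?_, ?_⟩
      · intro h0
        rw [h0, map_zero, norm_zero] at h1
        exact h1.false
      · refine le_trans ?_ (hN N₀ (le_abs_self _))
        have h2 := hC N₀ α
        have h3 : δ * (C * R N₀ * ‖α‖) ≤ c * R N₀ := by
          rw [hδ, div_mul_eq_mul_div, div_le_iff₀ (by positivity)]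
          have := hR N₀
          nlinarith [mul_pos (mul_pos hc hC0) this]
        exact (mul_le_mul_of_nonneg_left h2 hδ0.le).trans h3
  · rintro (_ | _) (_ | _) hij
    · exact absurd rfl hij
    · exact hdisj.symm
    · exact hdisj
    · exact absurd rfl hij
  · intro i j hij w hw
    obtain ⟨b, rfl⟩ : ∃ b : ℤ, FreeGroup.of () ^ b = w := by
      obtain ⟨b, hb⟩ := FreeGroup.freeGroupUnitEquivInt.symm.surjective w
      exact ⟨b, hb⟩
    have hb : b ≠ 0 := by
      rintro rfl
      exact hw (zpow_zero _)
    have hb1 : (1 : ℝ) ≤ |(b : ℝ)| := by exact_mod_cast Int.one_le_abs hb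
    rw [map_zpow, FreeGroup.lift_apply_of]
    rintro _ ⟨z, hz, rfl⟩
    rcases i with _ | _ <;> rcases j with _ | _
    · exact absurd rfl hij
    · -- a power of the transvection moves vectors with `φ z` not small close to `α`
      obtain ⟨hz0, hz⟩ := hz
      change ∃ t : ℂ, _
      have hzpos : 0 < ‖z‖ := norm_pos_iff.2 hz0
      have hφ : 0 < ‖φ z‖ := (by positivity : 0 < δ * ‖z‖).trans_le hz
      refine ⟨(((n : ℤ) * b : ℤ) : ℂ) * φ z, mul_ne_zero ?_ (norm_pos_iff.1 hφ), ?_⟩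
      · exact_mod_cast mul_ne_zero (by exact_mod_cast hn0.ne') hb
      · change ‖((y ^ n) ^ b) • z - _‖ < _
        rw [← zpow_natCast, ← zpow_mul, hsmul, hyz, add_sub_cancel_right, norm_mul, Int.cast_mul,
          norm_mul, Int.cast_natCast, Complex.norm_natCast, Complex.norm_intCast]
        calc ‖z‖ < (n * (δ * η)) * ‖z‖ := by nlinarith
          _ = η * (n * 1 * (δ * ‖z‖)) := by ring
          _ ≤ η * (n * |(b : ℝ)| * ‖φ z‖) := by gcongr
    · -- a power of `x` moves vectors close to `α` to vectors on which `φ` is not small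
      obtain ⟨t, ht0, ht⟩ := hz
      have htpos : 0 < ‖t‖ := norm_pos_iff.2 ht0
      set M : ℤ := (n : ℤ) * b with hM
      have hMN : (N₀ : ℤ) ≤ |M| := by
        rw [hM, abs_mul, Nat.abs_cast]
        have := Int.one_le_abs hb
        nlinarith [(by exact_mod_cast hnN : (N₀ : ℤ) < n)]
      have hz' : (x ^ n) ^ b • z = ρ (x ^ M) z := by
        rw [← zpow_natCast, ← zpow_mul, hsmul]
      change (x ^ n) ^ b • z ∈ _
      rw [hz']
      have hRM := hR M
      have h1 : c / 2 * R M * ‖t‖ ≤ ‖φ (ρ (x ^ M) z)‖ := by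
        have h2 : φ (ρ (x ^ M) z) = t * φ (ρ (x ^ M) α) + φ (ρ (x ^ M) (z - t • α)) := by
          simp only [map_sub, map_smul, smul_eq_mul]
          ring
        have h3 : ‖t * φ (ρ (x ^ M) α)‖ - ‖φ (ρ (x ^ M) (z - t • α))‖ ≤ ‖φ (ρ (x ^ M) z)‖ := by
          rw [h2]
          exact norm_sub_le_norm_add _ _
        rw [norm_mul] at h3
        have h4 : ‖φ (ρ (x ^ M) (z - t • α))‖ ≤ D * (C * R M * (η * ‖t‖)) :=
          (hD _).trans (by gcongr; exact (hC _ _).trans (by gcongr))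
        have h5 : ‖t‖ * (c * R M) ≤ ‖t‖ * ‖φ (ρ (x ^ M) α)‖ := by
          gcongr
          exact hN M hMN
        have h6 : D * C * η * (R M * ‖t‖) ≤ c / 2 * (R M * ‖t‖) := by gcongr
        nlinarith
      have h7 : ‖z‖ ≤ ‖t‖ * (‖α‖ + 1) := by
        have h8 : ‖z‖ ≤ ‖t • α‖ + ‖z - t • α‖ := by
          simpa using norm_add_le (t • α) (z - t • α)
        rw [norm_smul] at h8
        nlinarith
      refine ⟨?_, le_trans ?_ h1⟩
      · intro h0
        rw [h0, map_zero, norm_zero] at h1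
        have : 0 < c / 2 * R M * ‖t‖ := by positivity
        linarith
      · calc δ * ‖ρ (x ^ M) z‖ ≤ δ * (C * R M * (‖t‖ * (‖α‖ + 1))) := by
              gcongr
              exact (hC _ _).trans (by gcongr)
          _ = c / 2 * R M * ‖t‖ := by
              rw [hδ]
              field_simp
    · exact absurd rfl hij

/-! ### Chords of a regular polygon -/

/-- The ratio `sin ((n + 1) z) / sin z` is decreasing in `z` as long as `n z ≤ π`, because it is a
sum of the cosines of `n z, (n - 2) z, …`. -/
theorem sin_mul_sin_le_and_lt {x y : ℝ} (hx : 0 < x) (hxy : x < y) (hyπ : y < Real.pi) (n : ℕ)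
    (hn : n * y ≤ Real.pi) :
    Real.sin ((n + 1) * y) * Real.sin x ≤ Real.sin ((n + 1) * x) * Real.sin y ∧
      (n ≠ 0 → Real.sin ((n + 1) * y) * Real.sin x < Real.sin ((n + 1) * x) * Real.sin y) := by
  have hsx := Real.sin_pos_of_pos_of_lt_pi hx (hxy.trans hyπ)
  have hsy := Real.sin_pos_of_pos_of_lt_pi (hx.trans hxy) hyπ
  have hcos : ∀ m : ℕ, m ≠ 0 → m * y ≤ Real.pi → Real.cos (m * y) < Real.cos (m * x) := by
    intro m hm hmy
    have hm' : (0 : ℝ) < m := by positivity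
    exact Real.cos_lt_cos_of_nonneg_of_le_pi (by positivity) hmy (by gcongr)
  induction n using Nat.twoStepInduction with
  | zero => simp [mul_comm]
  | one =>
    have h1 := hcos 1 one_ne_zero hn
    have hlt : Real.sin (((1 : ℕ) + 1) * y) * Real.sin x <
        Real.sin (((1 : ℕ) + 1) * x) * Real.sin y := by
      have h2 : ((1 : ℕ) + 1 : ℝ) = 2 := by norm_num
      rw [h2, Real.sin_two_mul, Real.sin_two_mul]
      simp only [Nat.cast_one, one_mul] at h1
      nlinarith [mul_pos hsx hsy]
    exact ⟨hlt.le, fun _ => hlt⟩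
  | more m ih _ =>
    have hstep : ∀ z : ℝ, Real.sin (((m + 2 : ℕ) + 1) * z) =
        Real.sin ((m + 1) * z) + 2 * Real.cos ((m + 2 : ℕ) * z) * Real.sin z := by
      intro z
      have h1 : ((m + 2 : ℕ) + 1 : ℝ) * z = (m + 2 : ℕ) * z + z := by ring
      have h2 : ((m + 1 : ℝ)) * z = (m + 2 : ℕ) * z - z := by push_cast; ring
      rw [h1, h2, Real.sin_add, Real.sin_sub]
      ring
    have h1 := hcos (m + 2) (by omega) hn
    have hmy : (m : ℝ) * y ≤ (m + 2 : ℕ) * y :=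
      mul_le_mul_of_nonneg_right (by push_cast; linarith) (hx.trans hxy).le
    have h2 := (ih (hmy.trans hn)).1
    have hlt : Real.sin (((m + 2 : ℕ) + 1) * y) * Real.sin x <
        Real.sin (((m + 2 : ℕ) + 1) * x) * Real.sin y := by
      rw [hstep, hstep]
      nlinarith [mul_pos hsx hsy]
    exact ⟨hlt.le, fun _ => hlt⟩

theorem abs_sin_mul_mul_sin_lt {x : ℝ} (hx : 0 < x) {k j : ℕ} (hk : 2 ≤ k) (hj : 2 ≤ j)
    (hkx : k * x < Real.pi / 2) (hjx : j * x < Real.pi / 2) :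
    |Real.sin (k * j * x)| * Real.sin x < Real.sin (k * x) * Real.sin (j * x) := by
  have hπ := Real.pi_pos
  have hk2 : (2 : ℝ) ≤ k := by exact_mod_cast hk
  have hj2 : (2 : ℝ) ≤ j := by exact_mod_cast hj
  have hk1 : ((k - 1 : ℕ) : ℝ) = k - 1 := by
    push_cast [Nat.cast_sub (by omega : 1 ≤ k)]
    rfl
  have hxj : x < j * x := by nlinarith
  -- if `k j x ≤ π / 2`, compare `x` with `j x`; otherwise compare `x` with `π / (2 k)`
  rcases le_or_gt (k * j * x) (Real.pi / 2) with h | h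
  · have h1 := (sin_mul_sin_le_and_lt hx hxj (by linarith) (k - 1)
      (by rw [hk1]; nlinarith)).2 (by omega)
    rw [hk1, sub_add_cancel, ← mul_assoc] at h1
    rwa [abs_of_nonneg]
    exact Real.sin_nonneg_of_nonneg_of_le_pi (by positivity) (by linarith)
  · set y := Real.pi / 2 / k with hy
    have hky : k * y = Real.pi / 2 := by
      rw [hy]
      field_simp
    have hxy : x < y := by
      rw [hy, lt_div_iff₀ (by linarith)]
      linarith
    have hyj : y < j * x := by
      rw [hy, div_lt_iff₀ (by linarith)]
      linarith
    have h1 := (sin_mul_sin_le_and_lt hx hxy (by linarith) (k - 1)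
      (by rw [hk1]; nlinarith)).2 (by omega)
    rw [hk1, sub_add_cancel, hky, Real.sin_pi_div_two, one_mul] at h1
    have h2 : Real.sin y < Real.sin (j * x) :=
      Real.sin_lt_sin_of_lt_of_le_pi_div_two (by linarith) hjx.le hyj
    have h3 := Real.abs_sin_le_one (k * j * x)
    have h4 : 0 < Real.sin x := Real.sin_pos_of_pos_of_lt_pi hx (by linarith)
    have h5 : 0 < Real.sin (k * x) :=
      Real.sin_pos_of_pos_of_lt_pi (by positivity) (by linarith)
    nlinarith

section Chords

open ZMod

theorem norm_stdAddChar {p : ℕ} [NeZero p] (j : ZMod p) : ‖(stdAddChar j : ℂ)‖ = 1 := by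
  rw [stdAddChar_apply]
  exact Circle.norm_coe _

theorem stdAddChar_neg {p : ℕ} [NeZero p] (j : ZMod p) :
    (stdAddChar (-j) : ℂ) = (stdAddChar j)⁻¹ := AddChar.map_neg_eq_inv _ _

/-- The length of the chord from `1` to the `j`-th vertex of the regular `p`-gon. -/
noncomputable def chord {p : ℕ} [NeZero p] (j : ZMod p) : ℝ := ‖(stdAddChar j : ℂ) - 1‖

theorem chord_neg {p : ℕ} [NeZero p] (j : ZMod p) : chord (-j) = chord j := by
  have h0 : (stdAddChar j : ℂ) ≠ 0 := by
    rw [← norm_pos_iff, norm_stdAddChar]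
    exact one_pos
  have h1 : (stdAddChar (-j) : ℂ) - 1 = -(stdAddChar j)⁻¹ * ((stdAddChar j : ℂ) - 1) := by
    rw [stdAddChar_neg]
    field_simp
    ring
  rw [chord, h1, norm_mul, norm_neg, norm_inv, norm_stdAddChar, inv_one, one_mul, chord]

theorem chord_natCast {p : ℕ} [NeZero p] (j : ℕ) :
    chord (j : ZMod p) = 2 * |Real.sin (j * (Real.pi / p))| := by
  have h1 : (stdAddChar (j : ZMod p) : ℂ) =
      Complex.exp (Complex.I * ((2 * (j * (Real.pi / p)) : ℝ) : ℂ)) := by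
    have := stdAddChar_coe (N := p) (j : ℤ)
    rw [Int.cast_natCast] at this
    rw [this]
    congr 1
    push_cast
    ring
  rw [chord, h1, Complex.norm_exp_I_mul_ofReal_sub_one, mul_div_cancel_left₀ _ two_ne_zero,
    norm_mul, Real.norm_eq_abs, Real.norm_eq_abs, abs_two]

theorem chord_pos {p : ℕ} [NeZero p] {j : ZMod p} (hj : j ≠ 0) : 0 < chord j := by
  rw [chord, norm_pos_iff, sub_ne_zero, ← AddChar.map_zero_eq_one (stdAddChar (N := p))]
  exact fun h => hj (injective_stdAddChar h)

/-- Every residue class is, up to sign, the class of a natural number at most `p / 2`. -/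
theorem exists_natCast_eq_or_neg {p : ℕ} [NeZero p] (j : ZMod p) :
    ∃ n : ℕ, n ≤ p / 2 ∧ (j = n ∨ j = -n) := by
  refine ⟨j.valMinAbs.natAbs, natAbs_valMinAbs_le j, ?_⟩
  rw [natCast_natAbs_valMinAbs]
  split_ifs
  · exact Or.inl rfl
  · exact Or.inr (neg_neg j).symm

theorem exists_two_le_natCast_eq_or_neg {p : ℕ} [NeZero p] (hp : Odd p) {k : ZMod p}
    (h0 : k ≠ 0) (h1 : k ≠ 1) (h2 : k ≠ -1) :
    ∃ n : ℕ, 2 ≤ n ∧ n * (Real.pi / p) < Real.pi / 2 ∧ (k = n ∨ k = -n) := by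
  have hp0 : (0 : ℝ) < p := by exact_mod_cast NeZero.pos p
  obtain ⟨n, hn, hkn⟩ := exists_natCast_eq_or_neg k
  refine ⟨n, ?_, ?_, hkn⟩
  · by_contra! hlt
    interval_cases n <;> simp_all
  · have h3 : 2 * n < p := by
      obtain ⟨r, rfl⟩ := hp
      omega
    have h4 : 2 * (n : ℝ) < p := by exact_mod_cast h3
    rw [← mul_div_assoc, div_lt_div_iff₀ hp0 two_pos]
    nlinarith [Real.pi_pos]

theorem chord_natCast_of_lt {p : ℕ} [NeZero p] {n : ℕ} (hn : 1 ≤ n)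
    (h : n * (Real.pi / p) < Real.pi / 2) :
    chord (n : ZMod p) = 2 * Real.sin (n * (Real.pi / p)) := by
  have hp0 : (0 : ℝ) < p := by exact_mod_cast NeZero.pos p
  have hx : 0 < Real.pi / p := by positivity
  rw [chord_natCast, abs_of_pos (Real.sin_pos_of_pos_of_lt_pi (by positivity)
    (by linarith [Real.pi_pos]))]

theorem chord_one_lt {p : ℕ} [NeZero p] (hp : Odd p) {k : ZMod p} (hk0 : k ≠ 0) (hk1 : k ≠ 1)
    (hk2 : k ≠ -1) : chord (1 : ZMod p) < chord k := by
  have hp0 : (0 : ℝ) < p := by exact_mod_cast NeZero.pos p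
  obtain ⟨n, hn, hnx, hkn⟩ := exists_two_le_natCast_eq_or_neg hp hk0 hk1 hk2
  have e1 : chord k = chord (n : ZMod p) := by
    rcases hkn with rfl | rfl
    · rfl
    · rw [chord_neg]
  have hx : 0 < Real.pi / p := by positivity
  have hn2 : (2 : ℝ) ≤ n := by exact_mod_cast hn
  have hlt : (1 : ℕ) * (Real.pi / p) < n * (Real.pi / p) := by
    rw [Nat.cast_one]
    nlinarith
  have e2 := chord_natCast_of_lt le_rfl (hlt.trans hnx)
  rw [Nat.cast_one] at e2 hlt
  rw [e1, e2, chord_natCast_of_lt (by omega) hnx]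
  have := Real.sin_lt_sin_of_lt_of_le_pi_div_two (by linarith [Real.pi_pos]) hnx.le hlt
  linarith

/-- The chords at `k` and `j` have a larger product than those at `k j` and `1`: this is what makes
the absolute value of `(ζ ^ (k j) - 1) / (ζ ^ j - 1)` maximal exactly for `j = ± 1`. -/
theorem chord_mul_mul_chord_one_lt {p : ℕ} [NeZero p] (hp : Odd p) {k j : ZMod p}
    (hk0 : k ≠ 0) (hk1 : k ≠ 1) (hk2 : k ≠ -1) (hj0 : j ≠ 0) (hj1 : j ≠ 1) (hj2 : j ≠ -1) :
    chord (k * j) * chord (1 : ZMod p) < chord k * chord j := by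
  have hp0 : (0 : ℝ) < p := by exact_mod_cast NeZero.pos p
  obtain ⟨n, hn, hnx, hkn⟩ := exists_two_le_natCast_eq_or_neg hp hk0 hk1 hk2
  obtain ⟨l, hl, hlx, hjl⟩ := exists_two_le_natCast_eq_or_neg hp hj0 hj1 hj2
  have e1 : chord k = chord (n : ZMod p) := by
    rcases hkn with rfl | rfl
    · rfl
    · rw [chord_neg]
  have e2 : chord j = chord (l : ZMod p) := by
    rcases hjl with rfl | rfl
    · rfl
    · rw [chord_neg]
  have e3 : chord (k * j) = chord ((n * l : ℕ) : ZMod p) := by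
    push_cast
    rcases hkn with rfl | rfl <;> rcases hjl with rfl | rfl
    · rfl
    · rw [mul_neg, chord_neg]
    · rw [neg_mul, chord_neg]
    · rw [neg_mul_neg]
  have hx : 0 < Real.pi / p := by positivity
  have hn2 : (2 : ℝ) ≤ n := by exact_mod_cast hn
  have e4 : chord (1 : ZMod p) = 2 * Real.sin (Real.pi / p) := by
    have := chord_natCast_of_lt (p := p) le_rfl (by rw [Nat.cast_one]; nlinarith)
    rwa [Nat.cast_one, Nat.cast_one, one_mul] at this
  have h := abs_sin_mul_mul_sin_lt hx hn hl hnx hlx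
  rw [e1, e2, e3, e4, chord_natCast, chord_natCast_of_lt (by omega) hnx,
    chord_natCast_of_lt (by omega) hlx]
  push_cast
  linarith

end Chords

/-! ### Spectral decomposition of a Bass unit -/

section BassUnits

open ZMod hiding map_smul

/-- The value of the Bass unit with parameters `k, m` at the character of a cyclic group of order
`p` that sends the generator to `ψ j`, where `ψ` is the standard additive character. -/
noncomputable def bassEigenvalue {p : ℕ} [NeZero p] (k m : ℕ) (j : ZMod p) : ℂ :=
  if j = 0 then 1 else (∑ i ∈ Finset.range k, (stdAddChar j : ℂ) ^ i) ^ m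

theorem stdAddChar_ne_one {p : ℕ} [NeZero p] {j : ZMod p} (hj : j ≠ 0) :
    (stdAddChar j : ℂ) ≠ 1 := by
  rw [← AddChar.map_zero_eq_one (stdAddChar (N := p))]
  exact fun h => hj (injective_stdAddChar h)

theorem stdAddChar_pow {p : ℕ} [NeZero p] (j : ZMod p) (n : ℕ) :
    (stdAddChar j : ℂ) ^ n = stdAddChar ((n : ZMod p) * j) := by
  rw [← nsmul_eq_mul, AddChar.map_nsmul_eq_pow]

theorem norm_bassEigenvalue {p : ℕ} [NeZero p] (k m : ℕ) {j : ZMod p} (hj : j ≠ 0) :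
    ‖bassEigenvalue k m j‖ = (chord ((k : ZMod p) * j) / chord j) ^ m := by
  rw [bassEigenvalue, if_neg hj, geom_sum_eq (stdAddChar_ne_one hj), norm_pow, norm_div,
    stdAddChar_pow, chord, chord]

/-- The eigenvalues at `j` and `-j` are conjugate and differ by a `p`-th root of unity. -/
theorem bassEigenvalue_neg_pow {p : ℕ} [NeZero p] (k m : ℕ) (j : ZMod p) :
    bassEigenvalue k m (-j) ^ p = bassEigenvalue k m j ^ p := by
  rcases eq_or_ne j 0 with rfl | hj
  · rw [neg_zero]
  set ξ : ℂ := stdAddChar j with hξ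
  have hξ0 : ξ ≠ 0 := by
    rw [← norm_pos_iff, hξ, norm_stdAddChar]
    exact one_pos
  have hξp : ξ ^ p = 1 := by
    rw [hξ, stdAddChar_pow, natCast_self, zero_mul, AddChar.map_zero_eq_one]
  rw [bassEigenvalue, bassEigenvalue, if_neg hj, if_neg (neg_ne_zero.2 hj), stdAddChar_neg, ← hξ]
  rcases k with _ | k
  · simp
  have h1 : ξ ^ k * ∑ i ∈ Finset.range (k + 1), ξ⁻¹ ^ i = ∑ i ∈ Finset.range (k + 1), ξ ^ i := by
    rw [← Finset.sum_range_reflect, Finset.mul_sum]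
    refine Finset.sum_congr rfl fun i hi => ?_
    rw [Finset.mem_range] at hi
    rw [inv_pow, ← div_eq_mul_inv, div_eq_iff (pow_ne_zero _ hξ0), ← pow_add]
    congr 1
    omega
  have h2 : ((ξ ^ k) ^ m) ^ p = 1 := by
    rw [pow_right_comm, ← pow_mul ξ k p, mul_comm k p, pow_mul, hξp, one_pow, one_pow]
  rw [← h1, mul_pow, mul_pow, h2, one_mul]

section Extremes

variable {p : ℕ} [Fact p.Prime] (hodd : Odd p) {k m : ℕ} (hm : m ≠ 0) (hk0 : (k : ZMod p) ≠ 0)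
  (hk1 : (k : ZMod p) ≠ 1) (hk2 : (k : ZMod p) ≠ -1)

include hodd hm hk0 hk1 hk2

/-- The eigenvalues at `1` and `-1` are the ones of largest absolute value. -/
theorem norm_bassEigenvalue_lt {j : ZMod p} (hj1 : j ≠ 1) (hj2 : j ≠ -1) :
    ‖bassEigenvalue k m j‖ < ‖bassEigenvalue k m (1 : ZMod p)‖ := by
  have h1 : ‖bassEigenvalue k m (1 : ZMod p)‖ = (chord (k : ZMod p) / chord (1 : ZMod p)) ^ m := by
    rw [norm_bassEigenvalue k m one_ne_zero, mul_one]
  have hc1 : 0 < chord (1 : ZMod p) := chord_pos one_ne_zero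
  rw [h1]
  rcases eq_or_ne j 0 with rfl | hj0
  · rw [bassEigenvalue, if_pos rfl, norm_one]
    exact one_lt_pow₀ ((one_lt_div hc1).2 (chord_one_lt hodd hk0 hk1 hk2)) hm
  · rw [norm_bassEigenvalue k m hj0]
    have hcj : 0 < chord j := chord_pos hj0
    refine pow_lt_pow_left₀ ?_ (div_nonneg (norm_nonneg _) hcj.le) hm
    rw [div_lt_div_iff₀ hcj hc1]
    exact chord_mul_mul_chord_one_lt hodd hk0 hk1 hk2 hj0 hj1 hj2

/-- The eigenvalues at `j` and `-j`, where `k j = 1` modulo `p`, are the ones of smallest absolute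
value. -/
theorem lt_norm_bassEigenvalue {j : ZMod p} (hj1 : j ≠ (k : ZMod p)⁻¹) (hj2 : j ≠ -(k : ZMod p)⁻¹) :
    ‖bassEigenvalue k m ((k : ZMod p)⁻¹)‖ < ‖bassEigenvalue k m j‖ := by
  set l : ZMod p := (k : ZMod p)⁻¹ with hl
  have hkl : (k : ZMod p) * l = 1 := mul_inv_cancel₀ hk0
  have hl0 : l ≠ 0 := inv_ne_zero hk0
  have hl1 : l ≠ 1 := fun h => hk1 (by rw [← hkl, h, mul_one])
  have hl2 : l ≠ -1 := fun h => hk2 (by rw [← hkl, h, mul_neg, mul_one, neg_neg])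
  have hcl : 0 < chord l := chord_pos hl0
  have hc1 : 0 < chord (1 : ZMod p) := chord_pos one_ne_zero
  have h1 : ‖bassEigenvalue k m l‖ = (chord (1 : ZMod p) / chord l) ^ m := by
    rw [norm_bassEigenvalue k m hl0, hkl]
  rw [h1]
  rcases eq_or_ne j 0 with rfl | hj0
  · rw [bassEigenvalue, if_pos rfl, norm_one]
    exact pow_lt_one₀ (by positivity) ((div_lt_one hcl).2 (chord_one_lt hodd hl0 hl1 hl2)) hm
  · rw [norm_bassEigenvalue k m hj0]
    have hcj : 0 < chord j := chord_pos hj0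
    refine pow_lt_pow_left₀ ?_ (by positivity) hm
    rw [div_lt_div_iff₀ hcl hcj]
    -- apply the chord inequality to `l` and `i = k j`, whose product is `j`
    have h2 := chord_mul_mul_chord_one_lt hodd hl0 hl1 hl2 (mul_ne_zero hk0 hj0)
      (fun h => hj1 (by rw [← mul_one l, ← h, ← mul_assoc, mul_comm l, hkl, one_mul]))
      (fun h => hj2 (by rw [← mul_one l, ← mul_neg, ← h, ← mul_assoc, mul_comm l, hkl, one_mul]))
    rw [← mul_assoc, mul_comm l, hkl, one_mul] at h2
    linarith

end Extremes
section Spectral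

variable {G : Type*} [Group G] {V : Type*} [NormedAddCommGroup V] [NormedSpace ℂ V]
  (ρ : MonoidAlgebra ℤ G →+* Module.End ℂ V) {p : ℕ} [Fact p.Prime]

theorem map_powSum_apply (k : ℕ) {a : G} {w : V} {μ : ℂ}
    (hw : ρ (MonoidAlgebra.of ℤ G a) w = μ • w) :
    ρ (powSum k a) w = (∑ i ∈ Finset.range k, μ ^ i) • w := by
  have hpow : ∀ i : ℕ, ρ (MonoidAlgebra.of ℤ G a ^ i) w = μ ^ i • w := by
    intro i
    induction i with
    | zero => simp
    | succ i ih => rw [pow_succ, map_mul, Module.End.mul_apply, hw, map_smul, ih, smul_smul,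
        pow_succ, mul_comm]
  rw [powSum, map_sum, LinearMap.sum_apply, Finset.sum_smul]
  exact Finset.sum_congr rfl fun i _ => hpow i

/-- On the `ψ j`-eigenspace of `a`, a Bass unit on `a` acts as multiplication by
`bassEigenvalue k m j`. -/
theorem map_bassElement_apply {k m : ℕ} {a : G} (ha : orderOf a = p)
    (hkm : k ^ m ≡ 1 [MOD orderOf a]) {j : ZMod p} {w : V}
    (hw : ρ (MonoidAlgebra.of ℤ G a) w = (stdAddChar j : ℂ) • w) :
    ρ (bassElement k m a) w = bassEigenvalue k m j • w := by
  have hpow : ∀ n : ℕ, ρ (powSum k a ^ n) w =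
      (∑ i ∈ Finset.range k, (stdAddChar j : ℂ) ^ i) ^ n • w := by
    intro n
    induction n with
    | zero => simp
    | succ n ih => rw [pow_succ, map_mul, Module.End.mul_apply, map_powSum_apply ρ k hw, map_smul,
        ih, smul_smul, pow_succ, mul_comm]
  have hp : (p : ℤ) ≠ 0 := by exact_mod_cast (Fact.out : p.Prime).ne_zero
  rw [bassElement, hatSum, map_add, LinearMap.add_apply, hpow, map_zsmul, LinearMap.smul_apply,
    map_powSum_apply ρ _ hw, ha, ← Int.cast_smul_eq_zsmul ℂ, smul_smul, ← add_smul]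
  congr 1
  rw [bassEigenvalue]
  split_ifs with hj
  · subst hj
    have hdvd : (p : ℤ) ∣ 1 - (k : ℤ) ^ m := by
      have := Nat.modEq_iff_dvd.1 hkm
      rw [ha] at this
      simpa using this
    obtain ⟨c, hc⟩ := hdvd
    have hc' : (1 : ℂ) - (k : ℂ) ^ m = p * c := by exact_mod_cast congrArg (Int.cast : ℤ → ℂ) hc
    rw [hc, Int.mul_ediv_cancel_left _ hp]
    simp only [AddChar.map_zero_eq_one, one_pow, Finset.sum_const, Finset.card_range,
      nsmul_eq_mul, mul_one]
    linear_combination -hc'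
  · rw [geom_sum_eq (stdAddChar_ne_one hj) p, stdAddChar_pow, natCast_self, zero_mul,
      AddChar.map_zero_eq_one, sub_self, zero_div, mul_zero, add_zero]

/-- The projection onto the `ψ j`-eigenspace of `a`, where `a` has order `p`. -/
noncomputable def spectralProj (a : G) (j : ZMod p) : Module.End ℂ V :=
  (p : ℂ)⁻¹ • ∑ i : ZMod p, (stdAddChar (-(i * j)) : ℂ) • ρ (MonoidAlgebra.of ℤ G (a ^ i.val))

theorem sum_spectralProj (a : G) : ∑ j : ZMod p, spectralProj ρ a j = 1 := by
  have hp : (p : ℂ) ≠ 0 := by exact_mod_cast (Fact.out : p.Prime).ne_zero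
  simp only [spectralProj]
  rw [← Finset.smul_sum, Finset.sum_comm]
  have h1 : ∀ i : ZMod p, ∑ j : ZMod p, (stdAddChar (-(i * j)) : ℂ) =
      if i = 0 then (p : ℂ) else 0 := by
    intro i
    have := AddChar.sum_mulShift (R := ZMod p) (-i) (isPrimitive_stdAddChar p)
    rw [ZMod.card, Nat.cast_ite, Nat.cast_zero] at this
    simp only [neg_eq_zero] at this
    rw [← this]
    exact Finset.sum_congr rfl fun j _ => by rw [mul_neg, mul_comm]
  simp_rw [← Finset.sum_smul, h1, ite_smul, zero_smul]
  rw [Finset.sum_ite_eq' Finset.univ (0 : ZMod p), if_pos (Finset.mem_univ _), smul_smul,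
    inv_mul_cancel₀ hp, one_smul, val_zero, pow_zero, map_one, map_one]

theorem pow_val_add_one {a : G} (ha : orderOf a = p) (i : ZMod p) :
    a ^ (i + 1).val = a * a ^ i.val := by
  have : Fact (1 < p) := ⟨(Fact.out : p.Prime).one_lt⟩
  rw [val_add, val_one, ← pow_succ', pow_eq_pow_iff_modEq, ha]
  exact Nat.mod_modEq _ _

theorem map_of_spectralProj {a : G} (ha : orderOf a = p) (j : ZMod p) (w : V) :
    ρ (MonoidAlgebra.of ℤ G a) (spectralProj ρ a j w) =
      (stdAddChar j : ℂ) • spectralProj ρ a j w := by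
  simp only [spectralProj, LinearMap.smul_apply, LinearMap.sum_apply, map_smul, map_sum]
  rw [smul_comm]
  congr 1
  rw [← Equiv.sum_comp (Equiv.addRight (1 : ZMod p))
    (fun i => (stdAddChar (-(i * j)) : ℂ) • ρ (MonoidAlgebra.of ℤ G (a ^ i.val)) w),
    Finset.smul_sum]
  refine Finset.sum_congr rfl fun i _ => ?_
  rw [Equiv.coe_addRight, pow_val_add_one ha, map_mul, map_mul, Module.End.mul_apply, smul_smul,
    ← AddChar.map_add_eq_mul]
  congr 3
  ring

theorem norm_spectralProj_le (hρ : ∀ g w, ‖ρ (MonoidAlgebra.of ℤ G g) w‖ ≤ ‖w‖) (a : G)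
    (j : ZMod p) (w : V) : ‖spectralProj ρ a j w‖ ≤ ‖w‖ := by
  have hp : (0 : ℝ) < p := by exact_mod_cast (Fact.out : p.Prime).pos
  rw [spectralProj, LinearMap.smul_apply, LinearMap.sum_apply, norm_smul, norm_inv,
    Complex.norm_natCast, inv_mul_le_iff₀ hp]
  refine (norm_sum_le _ _).trans ((Finset.sum_le_card_nsmul _ _ ‖w‖ fun i _ => ?_).trans ?_)
  · rw [LinearMap.smul_apply, norm_smul, norm_stdAddChar, one_mul]
    exact hρ _ _
  · rw [Finset.card_univ, ZMod.card, nsmul_eq_mul]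

end Spectral

/-! ### Sums with two dominant terms -/

/-- If `μ j₀ = μ j₁` is the largest term in absolute value, attained nowhere else, and the
coefficients of these two terms do not cancel, then `∑ μ j ^ N * b j` grows like `μ j₀ ^ N`. -/
theorem exists_mul_pow_le_norm_sum {ι : Type*} [Fintype ι] (μ b : ι → ℂ) {j₀ j₁ : ι}
    (hne : j₀ ≠ j₁) (hμ : μ j₁ = μ j₀) (hμ0 : μ j₀ ≠ 0)
    (hlt : ∀ j, j ≠ j₀ → j ≠ j₁ → ‖μ j‖ < ‖μ j₀‖) (hb : b j₀ + b j₁ ≠ 0) :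
    ∃ c : ℝ, 0 < c ∧ ∃ N₀ : ℕ, ∀ N : ℕ, N₀ ≤ N → c * ‖μ j₀‖ ^ N ≤ ‖∑ j, μ j ^ N * b j‖ := by
  classical
  have hlim : Filter.Tendsto (fun N : ℕ => ∑ j, (μ j / μ j₀) ^ N * b j) Filter.atTop
      (nhds (∑ j, if j = j₀ ∨ j = j₁ then b j else 0)) := by
    refine tendsto_finsetSum _ fun j _ => ?_
    split_ifs with hj
    · have h1 : μ j / μ j₀ = 1 := by
        rcases hj with rfl | rfl
        · exact div_self hμ0
        · rw [hμ, div_self hμ0]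
      simp only [h1, one_pow, one_mul]
      exact tendsto_const_nhds
    · have h1 : ‖μ j / μ j₀‖ < 1 := by
        rw [norm_div, div_lt_one (norm_pos_iff.2 hμ0)]
        exact hlt j (fun h => hj (Or.inl h)) (fun h => hj (Or.inr h))
      simpa using (tendsto_pow_atTop_nhds_zero_of_norm_lt_one h1).mul_const (b j)
  have hsum : (∑ j, if j = j₀ ∨ j = j₁ then b j else 0) = b j₀ + b j₁ := by
    rw [← Finset.sum_filter, ← Finset.sum_pair hne]
    refine Finset.sum_congr ?_ fun _ _ => rfl
    ext j
    simp
  rw [hsum] at hlim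
  have hpos : 0 < ‖b j₀ + b j₁‖ := norm_pos_iff.2 hb
  obtain ⟨N₀, hN₀⟩ := Filter.eventually_atTop.1
    (hlim.norm.eventually (lt_mem_nhds (half_lt_self hpos)))
  refine ⟨‖b j₀ + b j₁‖ / 2, half_pos hpos, N₀, fun N hN => ?_⟩
  have h1 : ∑ j, μ j ^ N * b j = μ j₀ ^ N * ∑ j, (μ j / μ j₀) ^ N * b j := by
    rw [Finset.mul_sum]
    refine Finset.sum_congr rfl fun j _ => ?_
    rw [div_pow]
    field_simp
  rw [h1, norm_mul, norm_pow, mul_comm]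
  exact mul_le_mul_of_nonneg_left (hN₀ N hN).le (by positivity)

/-! ### A rational relation between roots of unity of prime order -/

/-- An integral linear relation between the `p`-th roots of unity has all coefficients equal; here
one of them is zero. -/
theorem eq_zero_of_sum_stdAddChar_eq_zero {p : ℕ} [Fact p.Prime] (e : ZMod p → ℤ) (he : e 0 = 0)
    {j : ZMod p} (hj : j ≠ 0) (h : ∑ i, (stdAddChar (i * j) : ℂ) * e i = 0) (i : ZMod p) :
    e i = 0 := by
  have hp : p.Prime := Fact.out
  have hpow : (stdAddChar j : ℂ) ^ p = 1 := by
    rw [stdAddChar_pow, natCast_self, zero_mul, AddChar.map_zero_eq_one]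
  have hprim : IsPrimitiveRoot (stdAddChar j : ℂ) p := by
    have := IsPrimitiveRoot.orderOf (stdAddChar j : ℂ)
    rwa [orderOf_eq_prime hpow (stdAddChar_ne_one hj)] at this
  set P : Polynomial ℤ := ∑ i : ZMod p, Polynomial.C (e i) * Polynomial.X ^ i.val with hP
  have hcoeff : ∀ i : ZMod p, P.coeff i.val = e i := by
    intro i
    rw [hP, Polynomial.finsetSum_coeff]
    simp only [Polynomial.coeff_C_mul, Polynomial.coeff_X_pow, (val_injective p).eq_iff, mul_ite,
      mul_one, mul_zero, Finset.sum_ite_eq, Finset.mem_univ, if_true]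
  have hcoeff_ge : ∀ n, p ≤ n → P.coeff n = 0 := by
    intro n hn
    rw [hP, Polynomial.finsetSum_coeff]
    refine Finset.sum_eq_zero fun i _ => ?_
    rw [Polynomial.coeff_C_mul, Polynomial.coeff_X_pow, if_neg, mul_zero]
    have := val_lt i
    omega
  have hroot : Polynomial.aeval (stdAddChar j : ℂ) P = 0 := by
    rw [← h, hP, map_sum]
    refine Finset.sum_congr rfl fun i _ => ?_
    rw [map_mul, map_pow, Polynomial.aeval_X, Polynomial.aeval_C, stdAddChar_pow,
      natCast_zmod_val, mul_comm]
    rfl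
  obtain ⟨Q, hQ⟩ : Polynomial.X ∣ P := by
    rw [Polynomial.X_dvd_iff, ← val_zero (n := p), hcoeff 0, he]
  have hQroot : Polynomial.aeval (stdAddChar j : ℂ) Q = 0 := by
    rw [hQ, map_mul, Polynomial.aeval_X] at hroot
    exact (mul_eq_zero.1 hroot).resolve_left (hprim.ne_zero hp.ne_zero)
  have hdvd : Polynomial.cyclotomic p ℤ ∣ Q := by
    rw [Polynomial.cyclotomic_eq_minpoly hprim hp.pos]
    exact minpoly.isIntegrallyClosed_dvd (hprim.isIntegral hp.pos) hQroot
  -- `Q` has degree less than `p - 1`, the degree of the cyclotomic polynomial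
  have hQ0 : Q = 0 := by
    by_contra hne
    have h1 := Polynomial.natDegree_le_of_dvd hdvd hne
    rw [Polynomial.natDegree_cyclotomic, Nat.totient_prime hp] at h1
    have h2 := hcoeff_ge (Q.natDegree + 1) (by omega)
    rw [hQ, Polynomial.coeff_X_mul] at h2
    exact hne (Polynomial.leadingCoeff_eq_zero.1 h2)
  rw [← hcoeff i, hQ, hQ0, mul_zero, Polynomial.coeff_zero]

section Growth

variable {G : Type*} [Group G] {V : Type*} [NormedAddCommGroup V] [NormedSpace ℂ V]
  (ρ : MonoidAlgebra ℤ G →+* Module.End ℂ V) {p : ℕ} [Fact p.Prime]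

/-- If the integers `φ (a ^ i α)` vanish at `i = 0` but do not add up to zero, then `α` has a
component in the sum of the `ψ j`- and `ψ (-j)`-eigenspaces on which `φ` does not vanish, for every
`j ≠ 0`: the possible exceptions form a Galois orbit, so one of them would force all. -/
theorem spectralProj_add_spectralProj_neg_ne_zero (a : G) (φ : V →ₗ[ℂ] ℂ) (α : V)
    (c : ZMod p → ℤ) (hc : ∀ i : ZMod p, φ (ρ (MonoidAlgebra.of ℤ G (a ^ i.val)) α) = c i)
    (hc0 : c 0 = 0) (hsum : ∑ i, c i ≠ 0) {j : ZMod p} (hj : j ≠ 0) :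
    φ (spectralProj ρ a j α) + φ (spectralProj ρ a (-j) α) ≠ 0 := by
  have hp : (p : ℂ) ≠ 0 := by exact_mod_cast (Fact.out : p.Prime).ne_zero
  have hproj : ∀ j : ZMod p, φ (spectralProj ρ a j α) =
      (p : ℂ)⁻¹ * ∑ i : ZMod p, (stdAddChar (-(i * j)) : ℂ) * c i := by
    intro j
    simp only [spectralProj, LinearMap.smul_apply, LinearMap.sum_apply, map_smul, map_sum, hc,
      smul_eq_mul]
  intro h
  have h1 : ∑ i : ZMod p, (stdAddChar (i * j) : ℂ) * (c i + c (-i) : ℤ) = 0 := by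
    rw [hproj, hproj, ← mul_add, mul_eq_zero] at h
    have h2 := h.resolve_left (inv_ne_zero hp)
    rw [← h2, ← Equiv.sum_comp (Equiv.neg (ZMod p))
      (fun i => (stdAddChar (-(i * j)) : ℂ) * c i), ← Finset.sum_add_distrib]
    refine Finset.sum_congr rfl fun i _ => ?_
    rw [Equiv.neg_apply, neg_mul, neg_neg, mul_neg, neg_neg]
    push_cast
    ring
  have h3 := eq_zero_of_sum_stdAddChar_eq_zero (fun i => c i + c (-i)) (by simp [hc0]) hj h1
  have h4 : ∑ i, (c i + c (-i)) = 2 * ∑ i, c i := by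
    have h5 : ∑ i, c (-i) = ∑ i, c i := Equiv.sum_comp (Equiv.neg (ZMod p)) c
    rw [Finset.sum_add_distrib, h5, two_mul]
  rw [Finset.sum_eq_zero fun i _ => h3 i] at h4
  exact hsum (by omega)

/-- A Bass unit `u` on an element `a` of prime order `p`, whose parameter `k` is not `±1` modulo
`p`, and a unit `v` that acts as a transvection `w ↦ w + φ w • α` have powers that generate a
non-abelian free group, provided the integers `φ (a ^ i α)` do not add up to zero. -/
theorem exists_bassUnit_pow_generatesNonabelianFree [Finite G]
    (hρ : ∀ g w, ‖ρ (MonoidAlgebra.of ℤ G g) w‖ ≤ ‖w‖) (hodd : Odd p) {a : G}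
    (ha : orderOf a = p) {k m : ℕ} (hm : 0 < m) (hkm : k ^ m ≡ 1 [MOD orderOf a])
    (hk1 : (k : ZMod p) ≠ 1) (hk2 : (k : ZMod p) ≠ -1) (v : (MonoidAlgebra ℤ G)ˣ)
    (φ : V →ₗ[ℂ] ℂ) {D : ℝ} (hD0 : 0 < D) (hD : ∀ w, ‖φ w‖ ≤ D * ‖w‖) (α : V)
    (hv : ∀ w, ρ v w = w + φ w • α) (c : ZMod p → ℤ)
    (hc : ∀ i : ZMod p, φ (ρ (MonoidAlgebra.of ℤ G (a ^ i.val)) α) = c i)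
    (hc0 : c 0 = 0) (hsum : ∑ i, c i ≠ 0) :
    ∃ n : ℕ, 0 < n ∧ GeneratesNonabelianFree (bassUnit k m a hm hkm ^ n) (v ^ n) := by
  have hp : p.Prime := Fact.out
  have hp0 : (0 : ℝ) < p := by exact_mod_cast hp.pos
  have hk0 : (k : ZMod p) ≠ 0 := by
    intro h0
    have h1 : ((k ^ m : ℕ) : ZMod p) = (1 : ℕ) := by
      rw [ZMod.natCast_eq_natCast_iff, ← ha]
      exact hkm
    rw [Nat.cast_pow, h0, zero_pow hm.ne', Nat.cast_one] at h1
    exact zero_ne_one h1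
  have hα : φ α = 0 := by
    have := hc 0
    rwa [val_zero, pow_zero, map_one, map_one, Module.End.one_apply, hc0, Int.cast_zero] at this
  set u := bassUnit k m a hm hkm with hu
  set l : ZMod p := (k : ZMod p)⁻¹ with hl
  have hl0 : l ≠ 0 := inv_ne_zero hk0
  set E : ZMod p → ℂ := fun j => bassEigenvalue k m j ^ p with hE
  have hmax : ∀ j : ZMod p, j ≠ 1 → j ≠ -1 → ‖E j‖ < ‖E 1‖ := by
    intro j h1 h2
    rw [hE, norm_pow, norm_pow]
    exact pow_lt_pow_left₀ (norm_bassEigenvalue_lt hodd hm.ne' hk0 hk1 hk2 h1 h2) (norm_nonneg _)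
      hp.ne_zero
  have hmin : ∀ j : ZMod p, j ≠ l → j ≠ -l → ‖E l‖ < ‖E j‖ := by
    intro j h1 h2
    rw [hE, norm_pow, norm_pow]
    exact pow_lt_pow_left₀ (lt_norm_bassEigenvalue hodd hm.ne' hk0 hk1 hk2 h1 h2) (norm_nonneg _)
      hp.ne_zero
  have hEneg : ∀ j, E (-j) = E j := fun j => bassEigenvalue_neg_pow k m j
  have hE0 : ∀ j, E j ≠ 0 := by
    intro j
    rw [hE]
    refine pow_ne_zero _ ?_
    rcases eq_or_ne j 0 with rfl | hj
    · rw [bassEigenvalue, if_pos rfl]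
      exact one_ne_zero
    · rw [← norm_pos_iff, norm_bassEigenvalue k m hj]
      exact pow_pos (div_pos (chord_pos (mul_ne_zero hk0 hj)) (chord_pos hj)) _
  have hne_neg : ∀ j : ZMod p, j ≠ 0 → j ≠ -j := by
    intro j hj h
    have h1 : (2 : ZMod p) * j = 0 := by
      rw [two_mul]
      nth_rewrite 1 [h]
      exact neg_add_cancel j
    have h2 : ((2 : ℕ) : ZMod p) = 0 := by exact_mod_cast (mul_eq_zero.1 h1).resolve_right hj
    rw [ZMod.natCast_eq_zero_iff, Nat.prime_dvd_prime_iff_eq hp Nat.prime_two] at h2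
    subst h2
    exact absurd hodd (by decide)
  have hle : ∀ j, ‖E j‖ ≤ ‖E 1‖ := by
    intro j
    by_cases h1 : j = 1
    · rw [h1]
    by_cases h2 : j = -1
    · rw [h2, hEneg]
    exact (hmax j h1 h2).le
  have hge : ∀ j, ‖E l‖ ≤ ‖E j‖ := by
    intro j
    by_cases h1 : j = l
    · rw [h1]
    by_cases h2 : j = -l
    · rw [h2, hEneg]
    exact (hmin j h1 h2).le
  let ρ' : (MonoidAlgebra ℤ G)ˣ →* Module.End ℂ V :=
    (ρ : MonoidAlgebra ℤ G →* Module.End ℂ V).comp (Units.coeHom _)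
  have hρ' : ∀ z : (MonoidAlgebra ℤ G)ˣ, ρ' z = ρ z := fun _ => rfl
  -- the powers of `u ^ p` act diagonally
  have heig : ∀ (N : ℕ) (j : ZMod p) (w : V),
      ρ' ((u ^ p) ^ N) (spectralProj ρ a j w) = E j ^ N • spectralProj ρ a j w := by
    have h1 : ∀ (N : ℕ) (j : ZMod p) (w : V),
        ρ' (u ^ N) (spectralProj ρ a j w) = bassEigenvalue k m j ^ N • spectralProj ρ a j w := by
      intro N j w
      induction N with
      | zero => simp
      | succ N ih =>
        rw [pow_succ', map_mul, Module.End.mul_apply, ih, map_smul, hρ']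
        change _ • ρ (bassElement k m a) _ = _
        rw [map_bassElement_apply ρ ha hkm (map_of_spectralProj ρ ha j w), smul_smul, pow_succ]
    intro N j w
    rw [← pow_mul, h1, pow_mul]
  have heig' : ∀ (N : ℕ) (j : ZMod p) (w : V),
      ρ' (((u ^ p) ^ N)⁻¹) (spectralProj ρ a j w) = (E j)⁻¹ ^ N • spectralProj ρ a j w := by
    intro N j w
    have h1 : spectralProj ρ a j w =
        ρ' ((u ^ p) ^ N) ((E j)⁻¹ ^ N • spectralProj ρ a j w) := by
      rw [map_smul, heig, smul_smul, inv_pow, inv_mul_cancel₀ (pow_ne_zero _ (hE0 j)), one_smul]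
    conv_lhs => rw [h1]
    rw [← Module.End.mul_apply, ← map_mul, inv_mul_cancel, map_one, Module.End.one_apply]
  have hdec : ∀ w : V, w = ∑ j : ZMod p, spectralProj ρ a j w := by
    intro w
    rw [← LinearMap.sum_apply, sum_spectralProj, Module.End.one_apply]
  have hact : ∀ (z : (MonoidAlgebra ℤ G)ˣ) (μ : ZMod p → ℂ),
      (∀ j w, ρ' z (spectralProj ρ a j w) = μ j • spectralProj ρ a j w) →
      ∀ w, ρ' z w = ∑ j, μ j • spectralProj ρ a j w := by
    intro z μ h w
    conv_lhs => rw [hdec w]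
    rw [map_sum]
    exact Finset.sum_congr rfl fun j _ => h j w
  have hbound : ∀ (z : (MonoidAlgebra ℤ G)ˣ) (μ : ZMod p → ℂ) (B : ℝ), 0 ≤ B →
      (∀ j w, ρ' z (spectralProj ρ a j w) = μ j • spectralProj ρ a j w) → (∀ j, ‖μ j‖ ≤ B) →
      ∀ w, ‖ρ' z w‖ ≤ p * B * ‖w‖ := by
    intro z μ B hB h hμ w
    rw [hact z μ h w]
    refine (norm_sum_le _ _).trans ((Finset.sum_le_card_nsmul _ _ (B * ‖w‖) fun j _ => ?_).trans ?_)
    · rw [norm_smul]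
      exact mul_le_mul (hμ j) (norm_spectralProj_le ρ hρ a j w) (norm_nonneg _) hB
    · rw [Finset.card_univ, ZMod.card, nsmul_eq_mul, mul_assoc]
  set b : ZMod p → ℂ := fun j => φ (spectralProj ρ a j α) with hb
  have hbne : ∀ j : ZMod p, j ≠ 0 → b j + b (-j) ≠ 0 := fun j hj =>
    spectralProj_add_spectralProj_neg_ne_zero ρ a φ α c hc hc0 hsum hj
  obtain ⟨c₁, hc₁, N₁, h₁⟩ := exists_mul_pow_le_norm_sum E b (hne_neg 1 one_ne_zero) (hEneg 1)
    (hE0 1) hmax (hbne 1 one_ne_zero)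
  obtain ⟨c₂, hc₂, N₂, h₂⟩ := exists_mul_pow_le_norm_sum (fun j => (E j)⁻¹) b (hne_neg l hl0)
    (by rw [hEneg]) (inv_ne_zero (hE0 l))
    (fun j h1 h2 => by
      rw [norm_inv, norm_inv]
      exact inv_strictAnti₀ (norm_pos_iff.2 (hE0 l)) (hmin j h1 h2)) (hbne l hl0)
  have hvp : ∀ w, ρ' (v ^ p) w = w + ((p : ℂ) • φ) w • α := by
    have h1 : ∀ (n : ℕ) w, ρ' (v ^ n) w = w + ((n : ℂ) • φ) w • α := by
      intro n w
      induction n with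
      | zero => simp
      | succ n ih =>
        rw [pow_succ', map_mul, Module.End.mul_apply, ih, hρ', hv, map_add, map_smul, hα,
          smul_zero, add_zero, add_assoc, ← add_smul]
        congr 2
        simp only [LinearMap.smul_apply, smul_eq_mul]
        push_cast
        ring
    exact h1 p
  have hφE : ∀ (z : (MonoidAlgebra ℤ G)ˣ) (μ : ZMod p → ℂ),
      (∀ j w, ρ' z (spectralProj ρ a j w) = μ j • spectralProj ρ a j w) →
      ‖((p : ℂ) • φ) (ρ' z α)‖ = p * ‖∑ j, μ j * b j‖ := by
    intro z μ h
    rw [LinearMap.smul_apply, hact z μ h, map_sum, norm_smul, Complex.norm_natCast]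
    simp only [map_smul, smul_eq_mul, hb]
  obtain ⟨n, hn, hfree⟩ := exists_pow_generatesNonabelianFree ρ' (u ^ p) (v ^ p) ((p : ℂ) • φ) α
    (D := p * D) (C := p) (c := p * min c₁ c₂) (by positivity) hp0
    (mul_pos hp0 (lt_min hc₁ hc₂))
    (fun w => by
      rw [LinearMap.smul_apply, norm_smul, Complex.norm_natCast, mul_assoc]
      exact mul_le_mul_of_nonneg_left (hD w) hp0.le)
    (by rw [LinearMap.smul_apply, hα, smul_zero]) hvp
    (fun N => if 0 ≤ N then ‖E 1‖ ^ N.toNat else ‖(E l)⁻¹‖ ^ (-N).toNat)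
    (fun N => by
      have h1 := norm_pos_iff.2 (hE0 1)
      have h2 := norm_pos_iff.2 (inv_ne_zero (hE0 l))
      split_ifs <;> positivity)
    (fun N w => by
      rcases le_or_gt 0 N with hN | hN
      · obtain ⟨N, rfl⟩ := Int.eq_ofNat_of_zero_le hN
        rw [if_pos hN, Int.toNat_natCast, zpow_natCast]
        refine hbound _ _ _ (by positivity) (heig N) (fun j => ?_) w
        rw [norm_pow]
        exact pow_le_pow_left₀ (norm_nonneg _) (hle j) _
      · obtain ⟨M, hM⟩ := Int.eq_ofNat_of_zero_le (by omega : 0 ≤ -N)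
        obtain rfl : N = -(M : ℤ) := by omega
        rw [if_neg (by omega), neg_neg, Int.toNat_natCast, zpow_neg, zpow_natCast]
        refine hbound _ _ _ (by positivity) (heig' M) (fun j => ?_) w
        rw [norm_pow]
        refine pow_le_pow_left₀ (norm_nonneg _) ?_ _
        rw [norm_inv, norm_inv]
        exact inv_anti₀ (norm_pos_iff.2 (hE0 l)) (hge j))
    (max N₁ N₂)
    (fun N hN => by
      rcases le_or_gt 0 N with hN' | hN'
      · obtain ⟨M, rfl⟩ := Int.eq_ofNat_of_zero_le hN'
        rw [if_pos hN', Int.toNat_natCast, zpow_natCast, hφE _ _ (heig M), mul_assoc]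
        rw [Nat.abs_cast] at hN
        refine mul_le_mul_of_nonneg_left (le_trans ?_ (h₁ M ?_)) hp0.le
        · exact mul_le_mul_of_nonneg_right (min_le_left _ _) (by positivity)
        · exact (le_max_left _ _).trans (by exact_mod_cast hN)
      · obtain ⟨M, hM⟩ := Int.eq_ofNat_of_zero_le (by omega : 0 ≤ -N)
        obtain rfl : N = -(M : ℤ) := by omega
        rw [if_neg (by omega), neg_neg, Int.toNat_natCast, zpow_neg, zpow_natCast,
          hφE _ _ (heig' M), mul_assoc]
        rw [abs_neg, Nat.abs_cast] at hN
        refine mul_le_mul_of_nonneg_left (le_trans ?_ (h₂ M ?_)) hp0.le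
        · exact mul_le_mul_of_nonneg_right (min_le_right _ _) (by positivity)
        · exact (le_max_right _ _).trans (by exact_mod_cast hN))
  refine ⟨p * n, mul_pos hp.pos hn, ?_⟩
  rwa [pow_mul, pow_mul]

end Growth

end BassUnits

/-! ### Bass units of finite order -/

section FiniteOrder

variable {G : Type*} [Group G]

theorem exists_add_smul_hatSum_pow {g : G} {y : MonoidAlgebra ℤ G} {e : ℤ}
    (hy : y * hatSum g = e • hatSum g) (hy' : hatSum g * y = e • hatSum g) (c : ℤ) (m : ℕ) :
    ∃ f : ℤ, (y + c • hatSum g) ^ m = y ^ m + f • hatSum g := by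
  have hpow : ∀ m : ℕ, y ^ m * hatSum g = e ^ m • hatSum g := by
    intro m
    induction m with
    | zero => simp
    | succ m ih => rw [pow_succ, mul_assoc, hy, mul_smul_comm, ih, smul_smul, pow_succ, mul_comm]
  induction m with
  | zero => exact ⟨0, by simp⟩
  | succ m ih =>
    obtain ⟨f, hf⟩ := ih
    refine ⟨c * e ^ m + f * e + f * c * orderOf g, ?_⟩
    rw [pow_succ, hf, add_mul, mul_add, mul_add, mul_smul_comm, hpow, smul_mul_assoc, hy',
      smul_mul_smul_comm, hatSum_mul_hatSum, smul_smul, smul_smul, smul_smul, add_smul, add_smul,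
      pow_succ]
    abel

/-- The augmentation of the integral group ring. -/
noncomputable def augmentation (G : Type*) [Group G] : MonoidAlgebra ℤ G →ₐ[ℤ] ℤ :=
  MonoidAlgebra.lift ℤ ℤ G 1

theorem augmentation_of (g : G) : augmentation G (MonoidAlgebra.of ℤ G g) = 1 := by
  simp [augmentation]

theorem augmentation_powSum (k : ℕ) (g : G) : augmentation G (powSum k g) = k := by
  simp only [powSum, map_sum, map_pow, augmentation_of, one_pow, Finset.sum_const,
    Finset.card_range, nsmul_eq_mul, mul_one]

/-- If `1 + g + ⋯ + g ^ (k - 1)` is `y` up to a multiple of `ĝ`, then the Bass unit is `y ^ m` up to a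
multiple of `ĝ`. The Bass unit has augmentation one, so the correction term vanishes as soon as
`y ^ m` has augmentation one. -/
theorem bassElement_eq_pow [Finite G] {k m : ℕ} {g : G} (hkm : k ^ m ≡ 1 [MOD orderOf g])
    {y : MonoidAlgebra ℤ G} {e c : ℤ} (hy : y * hatSum g = e • hatSum g)
    (hy' : hatSum g * y = e • hatSum g) (hk : powSum k g = y + c • hatSum g)
    (haug : (orderOf g : ℤ) ∣ 1 - augmentation G y ^ m → augmentation G y ^ m = 1) :
    bassElement k m g = y ^ m := by
  obtain ⟨f, hf⟩ := exists_add_smul_hatSum_pow hy hy' c m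
  have hn : (orderOf g : ℤ) ≠ 0 := by exact_mod_cast (orderOf_pos g).ne'
  obtain ⟨d, hd⟩ : (orderOf g : ℤ) ∣ 1 - (k : ℤ) ^ m := by
    simpa using Nat.modEq_iff_dvd.1 hkm
  have h1 : bassElement k m g = y ^ m + (f + d) • hatSum g := by
    rw [bassElement, hk, hf, hd, Int.mul_ediv_cancel_left _ hn, add_smul, add_assoc]
  have h2 : augmentation G (bassElement k m g) = 1 := by
    rw [bassElement, hd, Int.mul_ediv_cancel_left _ hn, map_add, map_pow, map_zsmul, hatSum,
      augmentation_powSum, augmentation_powSum, smul_eq_mul]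
    linear_combination -hd
  rw [h1, map_add, map_pow, map_zsmul, hatSum, augmentation_powSum, smul_eq_mul] at h2
  have h3 := haug ⟨f + d, by linear_combination -h2⟩
  have h4 : f + d = 0 := by
    rw [h3] at h2
    exact (mul_eq_zero.1 (by linear_combination h2 : (f + d) * (orderOf g : ℤ) = 0)).resolve_right hn
  rw [h1, h4, zero_smul, add_zero]

/-- For `k = 1` modulo `p` the Bass unit is trivial, and for `k = -1` it is `a ^ (-m)`. -/
theorem isOfFinOrder_bassUnit [Finite G] {p : ℕ} (hp : p.Prime) {a : G} (ha : orderOf a = p)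
    {k m : ℕ} (hk : 0 < k) (hm : 0 < m) (hkm : k ^ m ≡ 1 [MOD orderOf a])
    (h : (k : ZMod p) = 1 ∨ (k : ZMod p) = -1) : IsOfFinOrder (bassUnit k m a hm hkm) := by
  rw [isOfFinOrder_iff_pow_eq_one]
  by_cases h1 : (k : ZMod p) = 1
  · refine ⟨1, one_pos, ?_⟩
    have h2 : 1 ≡ k [MOD p] := by
      rw [← ZMod.natCast_eq_natCast_iff, h1, Nat.cast_one]
    obtain ⟨c, hc⟩ := (Nat.modEq_iff_dvd' hk).1 h2
    have hkc : k = 1 + orderOf a * c := by rw [ha]; omega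
    rw [pow_one]
    apply Units.ext
    change bassElement k m a = 1
    rw [bassElement_eq_pow hkm (y := 1) (e := 1) (c := c) (by simp) (by simp)
      (by rw [hkc, powSum_one_add]) (by simp), one_pow]
  · have h2 := h.resolve_left h1
    have h3 : p ∣ k + 1 := by
      rw [← ZMod.natCast_eq_zero_iff, Nat.cast_add, h2, Nat.cast_one, neg_add_cancel]
    obtain ⟨c, hc⟩ := h3
    refine ⟨p, hp.pos, ?_⟩
    have hp2 : p ≠ 2 := by
      rintro rfl
      exact h1 (h2.trans (by decide))
    have hinv : MonoidAlgebra.of ℤ G a ^ k = MonoidAlgebra.of ℤ G a⁻¹ := by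
      rw [← map_pow]
      congr 1
      rw [eq_inv_iff_mul_eq_one, ← pow_succ, hc, pow_mul, ← ha, pow_orderOf_eq_one, one_pow]
    have hsum : powSum k a = -MonoidAlgebra.of ℤ G a⁻¹ + (c : ℤ) • hatSum a := by
      have h4 : powSum (k + 1) a = (c : ℤ) • hatSum a := by
        rw [hc, ← ha, ← powSum_mul_powSum, pow_orderOf_eq_one]
        have h0 : powSum c (1 : G) = ((c : ℤ) : MonoidAlgebra ℤ G) := by
          simp only [powSum, map_one, one_pow, Finset.sum_const, Finset.card_range, nsmul_eq_mul,
            mul_one, Int.cast_natCast]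
        rw [h0, zsmul_eq_mul]
        exact (Int.cast_commute (c : ℤ) (hatSum a)).eq.symm
      rw [← h4, ← hinv, powSum, powSum, Finset.sum_range_succ]
      abel
    have hinv1 : MonoidAlgebra.of ℤ G a⁻¹ * hatSum a = hatSum a := by
      rw [← hinv, of_pow_mul_hatSum]
    have hinv2 : hatSum a * MonoidAlgebra.of ℤ G a⁻¹ = hatSum a := by
      conv_lhs => rw [← hatSum_mul_of a]
      rw [mul_assoc, ← map_mul, mul_inv_cancel, map_one, mul_one]
    apply Units.ext
    change bassElement k m a ^ p = 1
    have haug : augmentation G (-MonoidAlgebra.of ℤ G a⁻¹) = -1 := by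
      rw [map_neg, augmentation_of]
    have hdvd : (p : ℤ) ∣ 1 - (-1) ^ m → (-1 : ℤ) ^ m = 1 := by
      rintro hd
      rcases Nat.even_or_odd m with hm' | hm'
      · exact hm'.neg_one_pow
      · rw [hm'.neg_one_pow] at hd
        norm_num at hd
        have h5 : p ∣ 2 := by exact_mod_cast hd
        exact absurd ((Nat.prime_dvd_prime_iff_eq hp Nat.prime_two).1 h5) hp2
    have hbass := bassElement_eq_pow hkm (y := -MonoidAlgebra.of ℤ G a⁻¹) (e := -1) (c := c)
      (by rw [neg_mul, hinv1, neg_smul, one_smul]) (by rw [mul_neg, hinv2, neg_smul, one_smul])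
      hsum (by rw [haug, ha]; exact hdvd)
    have hpow : (-1 : ℤ) ^ m = 1 := by
      apply hdvd
      have h6 : (((1 - (-1) ^ m : ℤ)) : ZMod p) = 0 := by
        have h7 : ((k ^ m : ℕ) : ZMod p) = (1 : ℕ) := by
          rw [ZMod.natCast_eq_natCast_iff, ← ha]
          exact hkm
        push_cast at h7 ⊢
        rw [← h2, h7, sub_self]
      rwa [ZMod.intCast_zmod_eq_zero_iff_dvd] at h6
    have hpow' : Even m := by
      by_contra h8
      rw [(Nat.not_even_iff_odd.1 h8).neg_one_pow] at hpow
      exact absurd hpow (by decide)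
    rw [hbass, hpow'.neg_pow, ← map_pow, ← map_pow, ← pow_mul, mul_comm, pow_mul, inv_pow, ← ha,
      pow_orderOf_eq_one, inv_one, one_pow, map_one]

end FiniteOrder

/-! ### The action of `PSL(2, F)` on the projective line -/

section ProjectiveLine

open Matrix

variable {F : Type*} [Field F]

/-- The point `[1 : 0]` of the projective line. -/
noncomputable def pointInfty (F : Type*) [Field F] : ProjLine F :=
  Projectivization.mk F ![1, 0] (fun h => one_ne_zero (congrFun h 0))

/-- The point `[0 : 1]` of the projective line. -/
noncomputable def pointZero (F : Type*) [Field F] : ProjLine F :=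
  Projectivization.mk F ![0, 1] (fun h => one_ne_zero (congrFun h 1))

theorem pointInfty_ne_pointZero : pointInfty F ≠ pointZero F := by
  rw [pointInfty, pointZero, Ne, Projectivization.mk_eq_mk_iff']
  rintro ⟨a, ha⟩
  have := congrFun ha 0
  simp at this

theorem mk_smul_mk_eq_iff (A : Matrix.SpecialLinearGroup (Fin 2) F) {v w : Fin 2 → F} (hv : v ≠ 0)
    (hw : w ≠ 0) :
    (QuotientGroup.mk A : PSL2 F) • Projectivization.mk F v hv = Projectivization.mk F w hw ↔
      ∃ c : F, c • w = A.1 *ᵥ v := by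
  rw [Matrix.ProjectiveSpecialLinearGroup.smul_proj_mk, Projectivization.smul_mk,
    Projectivization.mk_eq_mk_iff']
  rfl

theorem mk_smul_pointInfty_iff (A : Matrix.SpecialLinearGroup (Fin 2) F) :
    (QuotientGroup.mk A : PSL2 F) • pointInfty F = pointInfty F ↔ A.1 1 0 = 0 := by
  rw [pointInfty, mk_smul_mk_eq_iff]
  constructor
  · rintro ⟨c, hc⟩
    have := congrFun hc 1
    simpa [Matrix.mulVec, dotProduct, Fin.sum_univ_two] using this.symm
  · intro h
    refine ⟨A.1 0 0, ?_⟩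
    ext i
    fin_cases i <;> simp [Matrix.mulVec, dotProduct, Fin.sum_univ_two, h]

theorem mk_smul_pointZero_iff (A : Matrix.SpecialLinearGroup (Fin 2) F) :
    (QuotientGroup.mk A : PSL2 F) • pointZero F = pointZero F ↔ A.1 0 1 = 0 := by
  rw [pointZero, mk_smul_mk_eq_iff]
  constructor
  · rintro ⟨c, hc⟩
    have := congrFun hc 0
    simpa [Matrix.mulVec, dotProduct, Fin.sum_univ_two] using this.symm
  · intro h
    refine ⟨A.1 1 1, ?_⟩
    ext i
    fin_cases i <;> simp [Matrix.mulVec, dotProduct, Fin.sum_univ_two, h]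

theorem mk_eq_mk_iff (A B : Matrix.SpecialLinearGroup (Fin 2) F) :
    (QuotientGroup.mk A : PSL2 F) = QuotientGroup.mk B ↔ ∃ r : F, r ^ 2 = 1 ∧ B.1 = r • A.1 := by
  rw [QuotientGroup.eq, Matrix.SpecialLinearGroup.mem_center_iff]
  refine exists_congr fun r => and_congr (by rw [Fintype.card_fin]) ?_
  rw [Matrix.scalar_apply, ← Matrix.smul_one_eq_diagonal]
  constructor
  · intro h
    have h1 : B = A * (A⁻¹ * B) := by rw [mul_inv_cancel_left]
    rw [h1, Matrix.SpecialLinearGroup.coe_mul, ← h, mul_smul_comm, mul_one]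
  · intro h
    rw [Matrix.SpecialLinearGroup.coe_mul, h, mul_smul_comm, ← Matrix.SpecialLinearGroup.coe_mul,
      inv_mul_cancel, Matrix.SpecialLinearGroup.coe_one]

theorem mk_eq_one_of_scalar {A : Matrix.SpecialLinearGroup (Fin 2) F} (h1 : A.1 0 1 = 0)
    (h2 : A.1 1 0 = 0) (h3 : A.1 0 0 = A.1 1 1) : (QuotientGroup.mk A : PSL2 F) = 1 := by
  have hdet := A.2
  rw [Matrix.det_fin_two, h1, h3, zero_mul, sub_zero] at hdet
  refine ((mk_eq_mk_iff 1 A).2 ⟨A.1 1 1, by rw [sq, hdet], ?_⟩).symm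
  ext i j
  fin_cases i <;> fin_cases j <;> simp [h1, h2, h3]

theorem exists_smul_pair_eq {x y x' y' : ProjLine F} (h : x ≠ y) (h' : x' ≠ y') :
    ∃ g : PSL2 F, g • x = x' ∧ g • y = y' := by
  have h2 : MulAction.IsMultiplyPretransitive (Matrix.SpecialLinearGroup (Fin 2) F) (ProjLine F) 2 :=
    inferInstance
  obtain ⟨g, hg⟩ := (MulAction.is_two_pretransitive_iff (G := Matrix.SpecialLinearGroup (Fin 2) F)).1 h2
    h h'
  exact ⟨QuotientGroup.mk g, hg⟩

/-- A projective transformation of the projective line with three fixed points is the identity. -/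
theorem eq_one_of_smul_eq_three {g : PSL2 F} {x y z : ProjLine F} (hxy : x ≠ y) (hxz : x ≠ z)
    (hyz : y ≠ z) (hx : g • x = x) (hy : g • y = y) (hz : g • z = z) : g = 1 := by
  obtain ⟨s, hs1, hs2⟩ := exists_smul_pair_eq hxy (pointInfty_ne_pointZero (F := F))
  have hconj : ∀ w : ProjLine F, g • w = w → (s * g * s⁻¹) • s • w = s • w := by
    intro w hw
    rw [mul_smul, inv_smul_smul, mul_smul, hw]
  have h1 := hconj x hx
  have h2 := hconj y hy
  have h3 := hconj z hz
  have hz1 : s • z ≠ pointInfty F := by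
    rw [← hs1]
    exact fun h => hxz (MulAction.injective s h).symm
  have hz2 : s • z ≠ pointZero F := by
    rw [← hs2]
    exact fun h => hyz (MulAction.injective s h).symm
  rw [hs1] at h1
  rw [hs2] at h2
  suffices h : s * g * s⁻¹ = 1 by
    rwa [mul_inv_eq_one, mul_eq_left] at h
  generalize s * g * s⁻¹ = b at *
  generalize s • z = w at *
  obtain ⟨B, rfl⟩ := QuotientGroup.mk_surjective b
  rw [mk_smul_pointInfty_iff] at h1
  rw [mk_smul_pointZero_iff] at h2
  induction w using Projectivization.ind with | _ v hv => ?_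
  rw [mk_smul_mk_eq_iff] at h3
  obtain ⟨c, hc⟩ := h3
  have hv0 : v 0 ≠ 0 := by
    intro h0
    refine hz2 ((Projectivization.mk_eq_mk_iff' F _ _ _ _).2 ⟨v 1, ?_⟩)
    ext i
    fin_cases i <;> simp [h0]
  have hv1 : v 1 ≠ 0 := by
    intro h0
    refine hz1 ((Projectivization.mk_eq_mk_iff' F _ _ _ _).2 ⟨v 0, ?_⟩)
    ext i
    fin_cases i <;> simp [h0]
  have e0 := congrFun hc 0
  have e1 := congrFun hc 1
  simp only [Pi.smul_apply, smul_eq_mul, Matrix.mulVec, dotProduct, Fin.sum_univ_two, h1, h2,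
    zero_mul, add_zero, zero_add] at e0 e1
  exact mk_eq_one_of_scalar h2 h1 ((mul_right_cancel₀ hv0 e0).symm.trans (mul_right_cancel₀ hv1 e1))

theorem not_stabilizer_eq_top (x : ProjLine F) : MulAction.stabilizer (PSL2 F) x ≠ ⊤ := by
  intro h
  have hfix : ∀ g : PSL2 F, g • x = x := fun g => by
    rw [← MulAction.mem_stabilizer_iff, h]
    exact Subgroup.mem_top g
  obtain ⟨y, hy⟩ : ∃ y, x ≠ y := by
    by_contra! hall
    exact pointInfty_ne_pointZero ((hall (pointInfty F)).symm.trans (hall (pointZero F)))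
  obtain ⟨g, hg, -⟩ := exists_smul_pair_eq hy hy.symm
  exact hy ((hfix g).symm.trans hg)

/-- If conjugation by every element of a point stabilizer in `PSL(2, q)` maps the element `a` of
that stabilizer to `a` or `a⁻¹`, then `a ^ 2 = 1` or `a ^ 3 = 1`, unless `q = 5`. -/
theorem sq_or_cube_eq_one_of_stabilizer_infty [Fintype F] (hodd : Odd (Fintype.card F))
    (h5 : Fintype.card F ≠ 5) {a : PSL2 F} (ha : a • pointInfty F = pointInfty F)
    (hconj : ∀ b : PSL2 F, b • pointInfty F = pointInfty F →
      b * a * b⁻¹ = a ∨ b * a * b⁻¹ = a⁻¹) : a ^ 2 = 1 ∨ a ^ 3 = 1 := by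
  obtain ⟨A, rfl⟩ := QuotientGroup.mk_surjective a
  rw [mk_smul_pointInfty_iff] at ha
  have hdet := A.2
  rw [Matrix.det_fin_two, ha, mul_zero, sub_zero] at hdet
  have key : ∀ B : Matrix.SpecialLinearGroup (Fin 2) F, B.1 1 0 = 0 → ∃ r : F, r ^ 2 = 1 ∧
      (B.1 * A.1 = r • (A.1 * B.1) ∨ B.1 * A.1 = r • (A.1.adjugate * B.1)) := by
    intro B hB
    have h := hconj (QuotientGroup.mk B) ((mk_smul_pointInfty_iff B).2 hB)
    rw [mul_inv_eq_iff_eq_mul, mul_inv_eq_iff_eq_mul, eq_comm, eq_comm (b := _⁻¹ * _)] at h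
    rcases h with h | h
    · obtain ⟨r, hr, hr'⟩ := (mk_eq_mk_iff (A * B) (B * A)).1 h
      exact ⟨r, hr, Or.inl (by simpa using hr')⟩
    · obtain ⟨r, hr, hr'⟩ := (mk_eq_mk_iff (A⁻¹ * B) (B * A)).1 h
      exact ⟨r, hr, Or.inr (by simpa using hr')⟩
  set s := A.1 0 0 with hs
  set t := A.1 1 1 with ht
  set β := A.1 0 1 with hβ
  have hA : A.1 = !![s, β; 0, t] := by
    ext i j
    fin_cases i <;> fin_cases j <;> simp [hs, hβ, ht, ha]
  rw [hA, Matrix.adjugate_fin_two_of] at key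
  have hs0 : s ≠ 0 := left_ne_zero_of_mul_eq_one hdet
  have ht0 : t ≠ 0 := right_ne_zero_of_mul_eq_one hdet
  have hA2 : A.1 ^ 2 = !![s ^ 2, β * (s + t); 0, t ^ 2] := by
    rw [hA, sq]
    ext i j
    fin_cases i <;> fin_cases j <;> simp <;> ring
  have hA3 : A.1 ^ 3 = !![s ^ 3, β * (s ^ 2 + s * t + t ^ 2); 0, t ^ 3] := by
    rw [pow_succ, hA2, hA]
    ext i j
    fin_cases i <;> fin_cases j <;> simp <;> ring
  -- conjugation by a transvection shows that the diagonal entries agree up to sign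
  have hst : t = s ∨ t = -s := by
    obtain ⟨r, hr, h | h⟩ := key ⟨!![1, 1; 0, 1], by simp⟩ (by simp)
    all_goals
      have h00 := congrFun (congrFun h 0) 0
      have h01 := congrFun (congrFun h 0) 1
      simp at h00 h01
    · have h1 : r = 1 := mul_right_cancel₀ hs0 (by rw [← h00, one_mul])
      rw [h1, one_mul] at h01
      exact Or.inl (by linear_combination h01)
    · rcases sq_eq_one_iff.1 hr with rfl | rfl
      · exact Or.inl (by linear_combination -h00)
      · exact Or.inr (by linear_combination h00)
  rcases hst with hts | hts
  swap
  · left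
    rw [← QuotientGroup.mk_pow]
    have hA2' : (A ^ 2).1 = _ := (Matrix.SpecialLinearGroup.coe_pow A 2).trans hA2
    refine mk_eq_one_of_scalar ?_ ?_ ?_ <;> rw [hA2'] <;> simp [hts]
  by_cases hβ0 : β = 0
  · left
    rw [mk_eq_one_of_scalar hβ0 ha hts.symm, one_pow]
  right
  -- conjugation by diagonal matrices shows that the units of `F` have exponent dividing 4
  have hunits : ∀ x : Fˣ, x ^ 4 = 1 := by
    intro x
    have hx : (x : F) ≠ 0 := x.ne_zero
    have hx2 : (x : F) ^ 2 = 1 ∨ (x : F) ^ 2 = -1 := by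
      obtain ⟨r, hr, h | h⟩ := key ⟨!![(x : F), 0; 0, (x : F)⁻¹], by simp [hx]⟩ (by simp)
      all_goals
        have h00 := congrFun (congrFun h 0) 0
        have h01 := congrFun (congrFun h 0) 1
        simp at h00 h01
        rw [hts] at *
        have h1 : r = 1 := mul_right_cancel₀ (mul_ne_zero hs0 hx) (by linear_combination -h00)
        rw [h1, one_mul] at h01
        field_simp at h01
      · exact Or.inl h01
      · exact Or.inr h01
    ext
    push_cast
    rcases hx2 with h | h
    · linear_combination ((x : F) ^ 2 + 1) * h
    · linear_combination ((x : F) ^ 2 - 1) * h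
  obtain ⟨x, hx⟩ := IsCyclic.exists_ofOrder_eq_natCard (α := Fˣ)
  have hcard : Fintype.card F - 1 ∣ 4 := by
    classical
    rw [← Fintype.card_units, ← Nat.card_eq_fintype_card, ← hx]
    exact orderOf_dvd_of_pow_eq_one (hunits x)
  have h3 : Fintype.card F = 3 := by
    have h1 := Nat.le_of_dvd (by norm_num) hcard
    have h2 := Fintype.one_lt_card (α := F)
    generalize Fintype.card F = q at *
    obtain ⟨l, rfl⟩ := hodd
    have : l = 1 ∨ l = 2 := by omega
    omega
  have h3' : (3 : F) = 0 := by
    have := FiniteField.cast_card_eq_zero F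
    rwa [h3] at this
  rw [← QuotientGroup.mk_pow]
  have hA3' : (A ^ 3).1 = _ := (Matrix.SpecialLinearGroup.coe_pow A 3).trans hA3
  refine mk_eq_one_of_scalar ?_ ?_ ?_ <;> rw [hA3'] <;> simp [hts]
  right
  linear_combination s ^ 2 * h3'

/-- A dihedral critical element of `PSL(2, q)` of order at least `5` has no fixed point on the
projective line, unless `q = 5`. -/
theorem IsDihedralCritical.smul_ne [Fintype F] (hodd : Odd (Fintype.card F))
    (h5 : Fintype.card F ≠ 5) {p : ℕ} (hp : 3 < p) {a : PSL2 F}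
    (ha : IsDihedralCritical p a) (x : ProjLine F) : a • x ≠ x := by
  intro hx
  have hcrit := ha.subgroup_eq (MulAction.stabilizer (PSL2 F) x) hx (not_stabilizer_eq_top x)
  obtain ⟨y, hy⟩ : ∃ y, x ≠ y := by
    by_contra! hall
    exact pointInfty_ne_pointZero ((hall (pointInfty F)).symm.trans (hall (pointZero F)))
  obtain ⟨s, hs, -⟩ := exists_smul_pair_eq hy (pointInfty_ne_pointZero (F := F))
  have hs' : s⁻¹ • pointInfty F = x := by rw [← hs, inv_smul_smul]
  have h := sq_or_cube_eq_one_of_stabilizer_infty hodd h5 (a := s * a * s⁻¹)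
    (by rw [mul_smul, hs', mul_smul, hx, hs]) (by
      intro b hb
      have hmem : s⁻¹ * b * s ∈ MulAction.stabilizer (PSL2 F) x := by
        rw [MulAction.mem_stabilizer_iff, mul_smul, hs, mul_smul, hb, hs']
      have h1 : (⟨s⁻¹ * b * s, hmem⟩ : MulAction.stabilizer (PSL2 F) x) ∈
          dihedralizer (⟨a, hx⟩ : MulAction.stabilizer (PSL2 F) x) := by
        rw [hcrit]
        exact Set.mem_univ _
      have hb' : b * (s * a * s⁻¹) * b⁻¹ =
          s * ((s⁻¹ * b * s) * a * (s⁻¹ * b * s)⁻¹) * s⁻¹ := by group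
      rw [hb']
      rcases h1 with h1 | h1
      · left
        have h2 := congrArg Subtype.val h1
        change (s⁻¹ * b * s) * a * (s⁻¹ * b * s)⁻¹ = a at h2
        rw [h2]
      · right
        have h2 := congrArg Subtype.val h1
        change (s⁻¹ * b * s) * a * (s⁻¹ * b * s)⁻¹ = a⁻¹ at h2
        rw [h2]
        group)
  have hord := ha.orderOf_eq
  rw [conj_pow, conj_pow, mul_inv_eq_one, mul_inv_eq_one, mul_eq_left, mul_eq_left] at h
  rcases h with h | h
  · have := Nat.le_of_dvd two_pos (orderOf_dvd_of_pow_eq_one h)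
    omega
  · have := Nat.le_of_dvd three_pos (orderOf_dvd_of_pow_eq_one h)
    omega

end ProjectiveLine

/-! ### The non-split torus -/

section NonsplitTorus

open Matrix

variable {F : Type*} [Field F]

theorem mk_eq_one_iff (A : Matrix.SpecialLinearGroup (Fin 2) F) :
    (QuotientGroup.mk A : PSL2 F) = 1 ↔ ∃ r : F, r ^ 2 = 1 ∧ A.1 = r • 1 := by
  rw [eq_comm]
  exact mk_eq_mk_iff 1 A

/-- The matrix of an element of determinant one without fixed points on the projective line has no
eigenvalue: its characteristic polynomial `X ^ 2 - t X + 1` has no root. -/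
theorem sq_ne_of_forall_smul_ne {A : Matrix.SpecialLinearGroup (Fin 2) F}
    (hfix : ∀ x : ProjLine F, (QuotientGroup.mk A : PSL2 F) • x ≠ x) (r : F) :
    r ^ 2 ≠ -1 + A.1.trace * r := by
  intro hr
  have hdet : (r • (1 : Matrix (Fin 2) (Fin 2) F) - A.1).det = 0 := by
    have h1 := A.2
    rw [Matrix.det_fin_two] at h1
    rw [Matrix.trace_fin_two] at hr
    rw [Matrix.det_fin_two]
    simp
    linear_combination hr + h1
  obtain ⟨v, hv, hv'⟩ := Matrix.exists_mulVec_eq_zero_iff.2 hdet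
  refine hfix (Projectivization.mk F v hv) ((mk_smul_mk_eq_iff A hv hv).2 ⟨r, ?_⟩)
  rwa [Matrix.sub_mulVec, Matrix.smul_mulVec, Matrix.one_mulVec, sub_eq_zero] at hv'

/-- The image in `M₂(F)` of an element `x + y ω` of the quadratic algebra with `ω ^ 2 = t ω - 1`,
where `t` is the trace of the unimodular matrix `A`: the matrix `x + y A`. -/
noncomputable def torusMatrix (A : Matrix.SpecialLinearGroup (Fin 2) F) :
    QuadraticAlgebra F (-1) A.1.trace →ₐ[F] Matrix (Fin 2) (Fin 2) F :=
  QuadraticAlgebra.lift ⟨A.1, by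
    have h1 := A.2
    rw [Matrix.det_fin_two] at h1
    rw [Matrix.trace_fin_two]
    ext i j
    fin_cases i <;> fin_cases j <;> simp [Matrix.mul_apply, Fin.sum_univ_two] <;>
      first | ring1 | linear_combination -h1⟩

theorem torusMatrix_apply (A : Matrix.SpecialLinearGroup (Fin 2) F)
    (z : QuadraticAlgebra F (-1) A.1.trace) :
    torusMatrix A z = z.re • (1 : Matrix (Fin 2) (Fin 2) F) + z.im • A.1 := rfl

theorem det_torusMatrix (A : Matrix.SpecialLinearGroup (Fin 2) F)
    (z : QuadraticAlgebra F (-1) A.1.trace) : (torusMatrix A z).det = z.norm := by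
  have h1 := A.2
  rw [Matrix.det_fin_two] at h1
  have h2 := Matrix.trace_fin_two A.1
  rw [torusMatrix_apply, QuadraticAlgebra.norm_def, Matrix.det_fin_two]
  generalize A.1.trace = t at *
  subst h2
  simp
  linear_combination z.im ^ 2 * h1

/-- The elements of norm one in the quadratic algebra act on the projective line through
`PSL(2, F)`. -/
noncomputable def torusHom (A : Matrix.SpecialLinearGroup (Fin 2) F) :
    (Units.map (QuadraticAlgebra.norm (a := (-1 : F)) (b := A.1.trace))).ker →* PSL2 F :=
  (QuotientGroup.mk' _).comp
    { toFun z := ⟨torusMatrix A z.1, by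
        rw [det_torusMatrix]
        exact congrArg Units.val z.2⟩
      map_one' := Subtype.ext (map_one (torusMatrix A))
      map_mul' z w := Subtype.ext (map_mul (torusMatrix A) z.1.1 w.1.1) }

variable [Fintype F]

/-- An element of `PSL(2, q)` without fixed points on the projective line is contained in a cyclic
subgroup of order `(q + 1) / 2`: the matrices commuting with it form a field with `q ^ 2` elements,
whose elements of norm one form a cyclic group of order `q + 1`. -/
theorem exists_orderOf_eq_and_mem_zpowers (hodd : Odd (Fintype.card F)) {a : PSL2 F}
    (hfix : ∀ x : ProjLine F, a • x ≠ x) :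
    ∃ g : PSL2 F, orderOf g = (Fintype.card F + 1) / 2 ∧ a ∈ Subgroup.zpowers g := by
  obtain ⟨A, rfl⟩ := QuotientGroup.mk_surjective a
  have hfact : Fact (∀ r : F, r ^ 2 ≠ -1 + A.1.trace * r) := ⟨sq_ne_of_forall_smul_ne hfix⟩
  set K := QuadraticAlgebra F (-1) A.1.trace with hK
  have hfin : Finite K := Finite.of_equiv _ (QuadraticAlgebra.equivProd (-1) A.1.trace).symm
  have hcardK : Nat.card K = Fintype.card F ^ 2 := by
    rw [Nat.card_congr (QuadraticAlgebra.equivProd (-1) A.1.trace), Nat.card_prod,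
      Nat.card_eq_fintype_card, sq]
  have hnorm : Algebra.norm F (S := K) = QuadraticAlgebra.norm := by
    ext z
    rw [Algebra.norm_apply, ← QuadraticAlgebra.det_toLinearMap_eq_norm]
    rfl
  have hsurj : Function.Surjective
      (Units.map (QuadraticAlgebra.norm (a := (-1 : F)) (b := A.1.trace))) := by
    have h := FiniteField.unitsMap_norm_surjective F K
    rwa [hnorm] at h
  set C := (Units.map (QuadraticAlgebra.norm (a := (-1 : F)) (b := A.1.trace))).ker with hC
  have hcardC : Nat.card C = Fintype.card F + 1 := by
    have h1 := Subgroup.card_mul_index C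
    rw [hC, Subgroup.index_ker, MonoidHom.range_eq_top.2 hsurj, Subgroup.card_top, ← hC,
      Nat.card_units, Nat.card_units, hcardK, Nat.card_eq_fintype_card (α := F)] at h1
    have h2 := Fintype.one_lt_card (α := F)
    clear_value C
    generalize Fintype.card F = q at *
    obtain ⟨q, rfl⟩ : ∃ r, q = r + 2 := ⟨q - 2, by omega⟩
    have h3 : (q + 2) ^ 2 - 1 = (q + 2 + 1) * (q + 2 - 1) := by
      rw [show q + 2 - 1 = q + 1 by omega]
      refine Nat.sub_eq_of_eq_add ?_
      ring
    rw [h3] at h1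
    exact Nat.eq_of_mul_eq_mul_right (by omega) h1
  obtain ⟨c, hc⟩ := IsCyclic.exists_generator (α := C)
  have hordc : orderOf c = Fintype.card F + 1 := by
    rw [orderOf_eq_card_of_forall_mem_zpowers hc, hcardC]
  -- the kernel of `torusHom` consists of `1` and `-1`
  have hker : ∀ z : C, torusHom A z = 1 ↔ z ^ 2 = 1 := by
    intro z
    have hA : A.1 1 0 ≠ 0 := by
      intro h
      exact hfix _ ((mk_smul_pointInfty_iff A).2 h)
    have hz2 : z ^ 2 = 1 ↔ z.1.1 ^ 2 = 1 := by
      rw [Subtype.ext_iff, Units.ext_iff]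
      rfl
    have h1 : torusHom A z = 1 ↔ ∃ r : F, r ^ 2 = 1 ∧
        z.1.1.re • (1 : Matrix (Fin 2) (Fin 2) F) + z.1.1.im • A.1 = r • 1 := mk_eq_one_iff _
    rw [h1, hz2, sq_eq_one_iff]
    constructor
    · rintro ⟨r, hr, h⟩
      have h10 := congrFun (congrFun h 1) 0
      have h00 := congrFun (congrFun h 0) 0
      simp [hA] at h10
      simp [h10] at h00
      rcases sq_eq_one_iff.1 hr with rfl | rfl
      · left
        ext <;> simp [h10, h00, QuadraticAlgebra.re_one, QuadraticAlgebra.im_one]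
      · right
        ext <;> simp [h10, h00, QuadraticAlgebra.re_one, QuadraticAlgebra.im_one]
    · rintro (h | h)
      · exact ⟨1, one_pow 2, by simp [h, QuadraticAlgebra.re_one, QuadraticAlgebra.im_one]⟩
      · exact ⟨-1, by norm_num, by simp [h, QuadraticAlgebra.re_one, QuadraticAlgebra.im_one]⟩
  obtain ⟨l, hl⟩ := hodd
  refine ⟨torusHom A c, ?_, ?_⟩
  · refine Nat.dvd_antisymm (orderOf_dvd_of_pow_eq_one ?_) ?_
    · rw [← map_pow, hker, ← pow_mul, ← orderOf_dvd_iff_pow_eq_one, hordc]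
      exact ⟨1, by omega⟩
    · have h1 := pow_orderOf_eq_one (torusHom A c)
      rw [← map_pow, hker, ← pow_mul, ← orderOf_dvd_iff_pow_eq_one, hordc] at h1
      obtain ⟨e, he⟩ := h1
      refine ⟨e, ?_⟩
      have h2 : (Fintype.card F + 1) = 2 * ((Fintype.card F + 1) / 2) := by omega
      rw [h2] at he
      nlinarith
  · have hω : (QuadraticAlgebra.omega : K).norm = 1 := by
      rw [QuadraticAlgebra.norm_def]
      simp
    obtain ⟨w, hw⟩ : ∃ w : C, w.1.1 = (QuadraticAlgebra.omega : K) := by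
      have h0 : (QuadraticAlgebra.omega : K) ≠ 0 := by
        intro h
        rw [h, QuadraticAlgebra.norm_zero] at hω
        exact zero_ne_one hω
      exact ⟨⟨Units.mk0 _ h0, Units.ext hω⟩, rfl⟩
    obtain ⟨i, hi⟩ := Subgroup.mem_zpowers_iff.1 (hc w)
    refine Subgroup.mem_zpowers_iff.2 ⟨i, ?_⟩
    rw [← map_zpow, hi]
    change (QuotientGroup.mk _ : PSL2 F) = QuotientGroup.mk A
    congr 1
    apply Subtype.ext
    change torusMatrix A w.1.1 = A.1
    rw [hw, torusMatrix_apply]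
    simp

end NonsplitTorus

/-! ### Cyclic groups acting freely -/

section Orbits

open scoped Classical

variable {G : Type*} [Group G] {X : Type*} [MulAction G X] {x : G}

/-- Suppose that `a` has odd order and moves every point, and that only the identity has three
fixed points. Then a cyclic group containing `a` acts freely: an element of it that fixes `y` also
fixes `a y` and `a ^ 2 y`. -/
theorem eq_one_of_mem_zpowers_of_smul_eq {a g : G} {p : ℕ} (hodd : Odd p)
    (ha : orderOf a = p) (hag : a ∈ Subgroup.zpowers g) (hfix : ∀ y : X, a • y ≠ y)
    (h3 : ∀ (b : G) (x y z : X), x ≠ y → x ≠ z → y ≠ z → b • x = x → b • y = y → b • z = z →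
      b = 1) :
    ∀ b ∈ Subgroup.zpowers g, ∀ y : X, b • y = y → b = 1 := by
  intro b hb y hy
  have hcomm : b * a = a * b := by
    obtain ⟨i, rfl⟩ := hag
    obtain ⟨j, rfl⟩ := hb
    exact ((Commute.refl g).zpow_zpow j i).eq
  have hcomm' : ∀ z : X, b • z = z → b • a • z = a • z := by
    intro z hz
    rw [← mul_smul, hcomm, mul_smul, hz]
  refine h3 b y (a • y) (a • a • y) (hfix y).symm ?_ (hfix (a • y)).symm hy (hcomm' _ hy)
    (hcomm' _ (hcomm' _ hy))
  intro h
  -- `a` is a power of `a ^ 2`, as its order is odd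
  obtain ⟨r, hr⟩ := hodd
  have hpow : ∀ k : ℕ, (a * a) ^ k • y = y := by
    intro k
    induction k with
    | zero => simp
    | succ k ih => rw [pow_succ, mul_smul, mul_smul, ← h, ih]
  have h1 : (a * a) ^ (r + 1) = a := by
    rw [← sq, ← pow_mul, show 2 * (r + 1) = p + 1 by omega, pow_succ, ← ha, pow_orderOf_eq_one,
      one_mul]
  have h2 := hpow (r + 1)
  rw [h1] at h2
  exact hfix y h2

theorem mem_of_mem_orbit_zpowers {O : Set X} (hO : ∀ y ∈ O, x • y ∈ O) [Finite G] {y z : X}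
    (hy : y ∈ O) (hz : z ∈ MulAction.orbit (Subgroup.zpowers x) y) : z ∈ O := by
  obtain ⟨⟨b, hb⟩, rfl⟩ := hz
  obtain ⟨i, rfl⟩ := (mem_powers_iff_mem_zpowers (x := x)).2 hb
  change x ^ i • y ∈ O
  induction i with
  | zero => simpa using hy
  | succ i ih =>
    rw [pow_succ', mul_smul]
    exact hO _ (ih (Subgroup.npow_mem_zpowers x i))

theorem cyclicOrbitsIn_univ : cyclicOrbitsIn x (Set.univ : Set X) = cyclicOrbits X x := by
  ext T
  simp [cyclicOrbitsIn]

variable [Fintype X]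

/-- For an element of finite order that acts freely, the sum over its powers is a sum over an
orbit. -/
theorem sum_range_smul_eq_sum_orbit [Finite G] {M : Type*} [AddCommMonoid M]
    (hfree : ∀ b ∈ Subgroup.zpowers x, ∀ y : X, b • y = y → b = 1) (f : X → M) (y : X) :
    ∑ i ∈ Finset.range (orderOf x), f ((x ^ i)⁻¹ • y) =
      ∑ z with z ∈ MulAction.orbit (Subgroup.zpowers x) y, f z := by
  refine Finset.sum_nbij (fun i => (x ^ i)⁻¹ • y) ?_ ?_ ?_ fun _ _ => rfl
  · intro i _
    rw [Finset.mem_filter_univ]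
    exact ⟨⟨(x ^ i)⁻¹, inv_mem (Subgroup.npow_mem_zpowers x i)⟩, rfl⟩
  · intro i hi j hj hij
    simp only [Finset.coe_range, Set.mem_Iio] at hi hj
    have h1 : (x ^ j * (x ^ i)⁻¹) • y = y := by
      rw [mul_smul]
      simp only at hij
      rw [hij, smul_inv_smul]
    have h2 := hfree _ (mul_mem (Subgroup.npow_mem_zpowers x j)
      (inv_mem (Subgroup.npow_mem_zpowers x i))) y h1
    rw [mul_inv_eq_one] at h2
    exact pow_injOn_Iio_orderOf hi hj h2.symm
  · rintro z hz
    simp only [Finset.coe_filter, Finset.mem_univ, true_and, Set.mem_ofPred_eq] at hz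
    obtain ⟨⟨b, hb⟩, rfl⟩ := hz
    have h1 := mem_zpowers_iff_mem_range_orderOf.1 (inv_mem hb)
    obtain ⟨i, hi, hi'⟩ := Finset.mem_image.1 h1
    refine ⟨i, by simpa using hi, ?_⟩
    simp only [hi', inv_inv]
    rfl

/-- A sum over an invariant set splits into sums over the orbits in it. -/
theorem sum_eq_sum_cyclicOrbitsIn [Finite G] {M : Type*} [AddCommMonoid M] {O : Set X}
    (hO : ∀ y ∈ O, x • y ∈ O) (f : X → M) :
    ∑ y with y ∈ O, f y = ∑ T ∈ (cyclicOrbitsIn x O).toFinset, ∑ y with y ∈ T, f y := by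
  rw [← Finset.sum_fiberwise_of_maps_to (t := (cyclicOrbitsIn x O).toFinset)
    (g := fun y => MulAction.orbit (Subgroup.zpowers x) y)]
  · refine Finset.sum_congr rfl fun T hT => Finset.sum_congr ?_ fun _ _ => rfl
    rw [Set.mem_toFinset] at hT
    obtain ⟨⟨y, rfl⟩, hTO⟩ := hT
    ext z
    simp only [Finset.mem_filter, Finset.mem_univ, true_and]
    rw [MulAction.orbit_eq_iff]
    exact ⟨fun h => h.2, fun h => ⟨hTO h, h⟩⟩
  · intro y hy
    rw [Finset.mem_filter_univ] at hy
    rw [Set.mem_toFinset]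
    exact ⟨⟨y, rfl⟩, fun z hz => mem_of_mem_orbit_zpowers hO hy hz⟩

theorem ncard_of_mem_cyclicOrbits [Finite G]
    (hfree : ∀ b ∈ Subgroup.zpowers x, ∀ y : X, b • y = y → b = 1) {T : Set X}
    (hT : T ∈ cyclicOrbits X x) : T.ncard = orderOf x := by
  obtain ⟨y, rfl⟩ := hT
  have h := sum_range_smul_eq_sum_orbit hfree (fun _ => (1 : ℕ)) y
  simp only [Finset.sum_const, Finset.card_range, smul_eq_mul, mul_one] at h
  rw [h, Set.ncard_eq_toFinset_card']
  congr 1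
  ext z
  simp

theorem ncard_cyclicOrbitsIn_mul_orderOf [Finite G]
    (hfree : ∀ b ∈ Subgroup.zpowers x, ∀ y : X, b • y = y → b = 1) {O : Set X}
    (hO : ∀ y ∈ O, x • y ∈ O) : (cyclicOrbitsIn x O).ncard * orderOf x = O.ncard := by
  have hcard : ∀ S : Set X, ∑ y with y ∈ S, 1 = S.ncard := by
    intro S
    rw [Finset.sum_const, smul_eq_mul, mul_one, Set.ncard_eq_toFinset_card']
    congr 1
    ext z
    simp
  rw [← hcard O, sum_eq_sum_cyclicOrbitsIn hO, Finset.sum_congr rfl fun T hT => ?_,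
    Finset.sum_const, smul_eq_mul, Set.ncard_eq_toFinset_card']
  rw [hcard]
  exact ncard_of_mem_cyclicOrbits hfree (Set.mem_toFinset.1 hT).1

end Orbits

/-! ### The permutation representation -/

section PermutationRepresentation

open scoped Classical

variable (G : Type*) [Group G] (X : Type*) [MulAction G X]

/-- The representation of the integral group ring on the complex-valued functions on a `G`-set. -/
noncomputable def permRep : MonoidAlgebra ℤ G →ₐ[ℤ] Module.End ℂ (X → ℂ) :=
  MonoidAlgebra.lift ℤ (Module.End ℂ (X → ℂ)) G
    { toFun g := LinearMap.funLeft ℂ ℂ fun y : X => g⁻¹ • y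
      map_one' := by
        ext
        simp [LinearMap.funLeft]
      map_mul' g h := by
        ext
        simp [LinearMap.funLeft, mul_smul] }

variable {G X}

theorem permRep_of (g : G) (w : X → ℂ) (y : X) :
    permRep G X (MonoidAlgebra.of ℤ G g) w y = w (g⁻¹ • y) := by
  rw [permRep, MonoidAlgebra.lift_of]
  rfl

theorem permRep_hatSum (g : G) (w : X → ℂ) (y : X) :
    permRep G X (hatSum g) w y = ∑ i ∈ Finset.range (orderOf g), w ((g ^ i)⁻¹ • y) := by
  simp only [hatSum, powSum, map_sum, LinearMap.sum_apply, Finset.sum_apply, ← map_pow, permRep_of]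

variable [Fintype X]

theorem norm_permRep_of_le (g : G) (w : X → ℂ) :
    ‖permRep G X (MonoidAlgebra.of ℤ G g) w‖ ≤ ‖w‖ := by
  rw [pi_norm_le_iff_of_nonneg (norm_nonneg _)]
  intro y
  rw [permRep_of]
  exact norm_le_pi_norm w _

variable [Finite G]

/-- The sum over the powers of `a` of the coefficients of `α` against `φ`, in terms of the orbits of
`a`. -/
theorem sum_coefficients_eq {a g h : G} {p : ℕ} [Fact p.Prime] (ha : orderOf a = p)
    (hafree : ∀ b ∈ Subgroup.zpowers a, ∀ y : X, b • y = y → b = 1) {O₀ O₁ : Set X}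
    (hO₀ : ∀ y ∈ O₀, a • y ∈ O₀) (hO₁ : ∀ y ∈ O₁, a • y ∈ O₁) (hO : ∀ y, y ∈ O₁ ↔ y ∉ O₀) :
    ∑ i : ZMod p, ∑ y, (if h • y ∈ O₀ then 1 else -1 : ℤ) *
      ((if (a ^ i.val)⁻¹ • y ∈ O₀ then 1 else 0) -
        if (a ^ i.val)⁻¹ • y ∈ g • O₀ then 1 else 0) =
      2 * ((∑ᶠ T ∈ cyclicOrbitsIn a O₀, ((h • T) ∩ O₀).ncard * (T ∩ (g • O₁)).ncard : ℕ) -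
        (∑ᶠ T ∈ cyclicOrbitsIn a O₁, ((h • T) ∩ O₀).ncard * (T ∩ (g • O₀)).ncard : ℕ)) := by
  set α : X → ℤ := fun y => (if y ∈ O₀ then 1 else 0) - if y ∈ g • O₀ then 1 else 0 with hα
  set ε : X → ℤ := fun y => if h • y ∈ O₀ then 1 else -1 with hε
  -- cardinalities as sums of indicator functions
  have hcard : ∀ S T : Set X, ((T ∩ S).ncard : ℤ) = ∑ y with y ∈ T, if y ∈ S then 1 else 0 := by
    intro S T
    rw [Finset.sum_boole, Finset.filter_filter, Set.ncard_eq_toFinset_card']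
    congr 2
    ext
    simp
  have hgO₁ : ∀ y, y ∈ g • O₁ ↔ y ∉ g • O₀ := by
    intro y
    rw [Set.mem_smul_set_iff_inv_smul_mem, Set.mem_smul_set_iff_inv_smul_mem, hO]
  have hzmod : ∀ (f : X → ℤ) (y : X), ∑ i : ZMod p, f ((a ^ i.val)⁻¹ • y) =
      ∑ z with z ∈ MulAction.orbit (Subgroup.zpowers a) y, f z := by
    intro f y
    rw [← sum_range_smul_eq_sum_orbit hafree f y, ha]
    refine Finset.sum_nbij (fun i => i.val) ?_ ?_ ?_ fun _ _ => rfl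
    · intro i _
      exact Finset.mem_range.2 i.val_lt
    · exact (ZMod.val_injective p).injOn
    · intro i hi
      exact ⟨i, Finset.mem_coe.2 (Finset.mem_univ _),
        ZMod.val_natCast_of_lt (Finset.mem_range.1 (Finset.mem_coe.1 hi))⟩
  have hstep : ∑ i : ZMod p, ∑ y, ε y * α ((a ^ i.val)⁻¹ • y) =
      ∑ y, ε y * ∑ z with z ∈ MulAction.orbit (Subgroup.zpowers a) y, α z := by
    rw [Finset.sum_comm]
    refine Finset.sum_congr rfl fun y _ => ?_
    rw [← Finset.mul_sum, hzmod]
  have horb : ∀ O : Set X, (∀ y ∈ O, a • y ∈ O) →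
      ∑ y with y ∈ O, ε y * ∑ z with z ∈ MulAction.orbit (Subgroup.zpowers a) y, α z =
        ∑ T ∈ (cyclicOrbitsIn a O).toFinset,
          (2 * (((h • T) ∩ O₀).ncard : ℤ) - p) * ∑ z with z ∈ T, α z := by
    intro O hOa
    rw [sum_eq_sum_cyclicOrbitsIn hOa]
    refine Finset.sum_congr rfl fun T hT => ?_
    have hT' := (Set.mem_toFinset.1 hT).1
    have h1 : ∀ y ∈ T, MulAction.orbit (Subgroup.zpowers a) y = T := by
      obtain ⟨z, rfl⟩ := hT'
      intro y hy
      exact MulAction.orbit_eq_iff.2 hy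
    have h2 : ∑ y with y ∈ T, ε y = 2 * (((h • T) ∩ O₀).ncard : ℤ) - p := by
      have h3 : ((h • T) ∩ O₀).ncard = (T ∩ (h⁻¹ • O₀)).ncard := by
        rw [← Set.ncard_smul_set h (T ∩ _), Set.smul_set_inter, smul_inv_smul]
      have h4 : (p : ℤ) = ∑ y with y ∈ T, 1 := by
        rw [← ha, ← ncard_of_mem_cyclicOrbits hafree hT', ← Set.inter_univ T, hcard]
        simp
      rw [h3, hcard, h4, Finset.mul_sum, ← Finset.sum_sub_distrib]
      refine Finset.sum_congr rfl fun y _ => ?_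
      simp only [hε, Set.mem_smul_set_iff_inv_smul_mem, inv_inv]
      split_ifs <;> norm_num
    rw [← h2, Finset.sum_mul]
    refine Finset.sum_congr rfl fun y hy => ?_
    rw [h1 y (Finset.mem_filter_univ y |>.1 hy)]
  have hα₀ : ∀ T ⊆ O₀, ∑ z with z ∈ T, α z = ((T ∩ (g • O₁)).ncard : ℤ) := by
    intro T hT
    rw [hcard]
    refine Finset.sum_congr rfl fun z hz => ?_
    rw [Finset.mem_filter_univ] at hz
    simp only [hα, if_pos (hT hz), hgO₁]
    split_ifs <;> norm_num
  have hα₁ : ∀ T ⊆ O₁, ∑ z with z ∈ T, α z = -((T ∩ (g • O₀)).ncard : ℤ) := by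
    intro T hT
    rw [hcard, ← Finset.sum_neg_distrib]
    refine Finset.sum_congr rfl fun z hz => ?_
    rw [Finset.mem_filter_univ] at hz
    simp only [hα, if_neg ((hO z).1 (hT hz)), zero_sub]
  -- the complements of `O₀ ∩ g O₀` in `O₀` and in `g O₀` have the same size
  have hbal : ∑ T ∈ (cyclicOrbitsIn a O₀).toFinset, ((T ∩ (g • O₁)).ncard : ℤ) =
      ∑ T ∈ (cyclicOrbitsIn a O₁).toFinset, ((T ∩ (g • O₀)).ncard : ℤ) := by
    simp only [hcard]
    rw [← sum_eq_sum_cyclicOrbitsIn hO₀, ← sum_eq_sum_cyclicOrbitsIn hO₁, ← hcard, ← hcard]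
    have e1 : (O₀ ∩ g • O₁).ncard + (O₀ ∩ g • O₀).ncard = O₀.ncard := by
      rw [← Set.ncard_inter_add_ncard_sdiff_eq_ncard O₀ (g • O₀), add_comm]
      congr 2
      ext y
      simp [hgO₁]
    have e2 : (O₁ ∩ g • O₀).ncard + (O₀ ∩ g • O₀).ncard = O₀.ncard := by
      rw [← Set.ncard_smul_set g O₀, ← Set.ncard_inter_add_ncard_sdiff_eq_ncard (g • O₀) O₀,
        add_comm, Set.inter_comm]
      congr 2
      ext y
      simp [hO, and_comm]
    omega
  have hsplit : ∀ f : X → ℤ, ∑ y, f y = ∑ y with y ∈ O₀, f y + ∑ y with y ∈ O₁, f y := by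
    intro f
    rw [← Finset.sum_filter_add_sum_filter_not Finset.univ (fun y => y ∈ O₀)]
    congr 2
    ext y
    simp [hO]
  rw [hstep, hsplit, horb _ hO₀, horb _ hO₁, finsum_mem_eq_toFinset_sum, finsum_mem_eq_toFinset_sum,
    Finset.sum_congr rfl fun T hT => by rw [hα₀ T (Set.mem_toFinset.1 hT).2],
    Finset.sum_congr (s₁ := (cyclicOrbitsIn a O₁).toFinset) rfl fun T hT => by
      rw [hα₁ T (Set.mem_toFinset.1 hT).2]]
  push_cast
  simp only [sub_mul, mul_neg, Finset.sum_sub_distrib, Finset.sum_neg_distrib, mul_assoc,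
    ← Finset.mul_sum]
  rw [hbal]
  ring

end PermutationRepresentation

/-! ### Bass and bicyclic units acting on a set with two orbits -/

section TwoOrbits

open scoped Classical

variable {G : Type*} [Group G] [Finite G] {X : Type*} [Fintype X] [MulAction G X]

/-- If `⟨g⟩` acts freely with the two orbits `O₀` and `O₁`, then on functions on `X` the bicyclic
unit on `g ^ h` and `h` is the transvection with direction `1_{O₀} - 1_{g ^ h O₀}` and functional
`w ↦ w (h⁻¹ O₀) - w (h⁻¹ O₁)`. -/
theorem permRep_bicyclicElement {g h : G}
    (hfree : ∀ b ∈ Subgroup.zpowers g, ∀ y : X, b • y = y → b = 1) {O₀ O₁ : Set X}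
    (hO₀ : O₀ ∈ cyclicOrbits X g) (hO₁ : O₁ ∈ cyclicOrbits X g) (hO : ∀ y, y ∈ O₁ ↔ y ∉ O₀)
    (w : X → ℂ) :
    permRep G X (bicyclicElement (h⁻¹ * g * h) h) w =
      w + (∑ y, (if h • y ∈ O₀ then 1 else -1) * w y) •
        fun y => (if y ∈ O₀ then 1 else 0) - if y ∈ (h⁻¹ * g * h) • O₀ then 1 else 0 := by
  have hord : orderOf (h⁻¹ * g * h) = orderOf g := by
    refine SemiconjBy.orderOf_eq h ?_
    rw [SemiconjBy]
    group
  have hW : ∀ y, permRep G X (hatSum (h⁻¹ * g * h)) w (h⁻¹ • y) =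
      ∑ z with z ∈ MulAction.orbit (Subgroup.zpowers g) y, w (h⁻¹ • z) := by
    intro y
    rw [permRep_hatSum, hord, ← sum_range_smul_eq_sum_orbit hfree (fun z => w (h⁻¹ • z)) y]
    refine Finset.sum_congr rfl fun i _ => ?_
    have h1 : (h⁻¹ * g * h) ^ i = h⁻¹ * g ^ i * h := by
      simpa using conj_pow (i := i) (a := h⁻¹) (b := g)
    rw [h1, ← mul_smul, ← mul_smul]
    congr 2
    group
  have horb : ∀ O ∈ cyclicOrbits X g, ∀ y ∈ O, MulAction.orbit (Subgroup.zpowers g) y = O := by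
    rintro _ ⟨z, rfl⟩ y hy
    exact MulAction.orbit_eq_iff.2 hy
  set S : Set X → ℂ := fun O => ∑ z with z ∈ O, w (h⁻¹ • z) with hS
  have hW' : ∀ y, permRep G X (hatSum (h⁻¹ * g * h)) w (h⁻¹ • y) =
      S O₁ + (S O₀ - S O₁) * if y ∈ O₀ then 1 else 0 := by
    intro y
    rw [hW]
    split_ifs with hy
    · rw [horb _ hO₀ y hy]
      ring
    · rw [horb _ hO₁ y ((hO y).2 hy)]
      ring
  have hφ : ∑ y, (if h • y ∈ O₀ then 1 else -1) * w y = S O₀ - S O₁ := by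
    have h1 := Equiv.sum_comp (MulAction.toPerm h⁻¹ : Equiv.Perm X)
      (fun y => (if h • y ∈ O₀ then 1 else -1) * w y)
    rw [← h1, hS]
    simp only [MulAction.toPerm_apply, smul_inv_smul]
    rw [← Finset.sum_filter_add_sum_filter_not Finset.univ (fun y => y ∈ O₀), sub_eq_add_neg,
      ← Finset.sum_neg_distrib]
    congr 1
    · refine Finset.sum_congr rfl fun y hy => ?_
      rw [if_pos (Finset.mem_filter.1 hy).2, one_mul]
    · refine Finset.sum_congr ?_ fun y hy => ?_
      · ext y
        simp [hO]
      · have h2 : y ∉ O₀ := (hO y).1 (Finset.mem_filter.1 hy).2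
        rw [if_neg h2, neg_one_mul]
  ext y
  rw [hφ, bicyclicElement, map_add, map_one, LinearMap.add_apply, Module.End.one_apply, map_mul,
    map_mul, map_sub, map_one, Module.End.mul_apply, Module.End.mul_apply, LinearMap.sub_apply,
    Module.End.one_apply]
  simp only [Pi.add_apply, Pi.sub_apply, Pi.smul_apply, permRep_of, smul_eq_mul]
  rw [hW', hW', Set.mem_smul_set_iff_inv_smul_mem]
  ring

/-- The freeness criterion for a Bass unit and a bicyclic unit of a group acting on a set `X`, where
the cyclic group `⟨g⟩` acts freely with two orbits. -/
theorem exists_bassUnit_bicyclicUnit_free {a g h : G} {p : ℕ} [Fact p.Prime] (hodd : Odd p)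
    (ha : orderOf a = p) (hag : a ∈ Subgroup.zpowers g)
    (hfree : ∀ b ∈ Subgroup.zpowers g, ∀ y : X, b • y = y → b = 1) {O₀ O₁ : Set X}
    (hO₀ : O₀ ∈ cyclicOrbits X g) (hO₁ : O₁ ∈ cyclicOrbits X g) (hO : ∀ y, y ∈ O₁ ↔ y ∉ O₀)
    {k m : ℕ} (hm : 0 < m) (hkm : k ^ m ≡ 1 [MOD orderOf a]) (hk1 : (k : ZMod p) ≠ 1)
    (hk2 : (k : ZMod p) ≠ -1)
    (hne : (∑ᶠ T ∈ cyclicOrbitsIn a O₀,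
        ((h • T) ∩ O₀).ncard * (T ∩ ((h⁻¹ * g * h) • O₁)).ncard) ≠
      ∑ᶠ T ∈ cyclicOrbitsIn a O₁, ((h • T) ∩ O₀).ncard * (T ∩ ((h⁻¹ * g * h) • O₀)).ncard) :
    ∃ n : ℕ, 0 < n ∧ GeneratesNonabelianFree (bassUnit k m a hm hkm ^ n)
      (bicyclicUnit (h⁻¹ * g * h) h ^ n) := by
  have hinv : ∀ O ∈ cyclicOrbits X g, ∀ b ∈ Subgroup.zpowers g, ∀ y ∈ O, b • y ∈ O := by
    rintro _ ⟨z, rfl⟩ b hb y hy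
    exact MulAction.mem_orbit_of_mem_orbit (⟨b, hb⟩ : Subgroup.zpowers g) hy
  have hafree : ∀ b ∈ Subgroup.zpowers a, ∀ y : X, b • y = y → b = 1 := fun b hb =>
    hfree b (Subgroup.zpowers_le.2 hag hb)
  set c : ZMod p → ℤ := fun i => ∑ y, (if h • y ∈ O₀ then 1 else -1 : ℤ) *
    ((if (a ^ i.val)⁻¹ • y ∈ O₀ then 1 else 0) -
      if (a ^ i.val)⁻¹ • y ∈ (h⁻¹ * g * h) • O₀ then 1 else 0) with hc
  have hX : 0 < Fintype.card X := by
    obtain ⟨y, -⟩ := hO₀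
    exact Fintype.card_pos_iff.2 ⟨y⟩
  let φ : (X → ℂ) →ₗ[ℂ] ℂ :=
    ∑ y, (if h • y ∈ O₀ then 1 else -1 : ℂ) • LinearMap.proj (R := ℂ) (φ := fun _ : X => ℂ) y
  have hφ : ∀ w, φ w = ∑ y, (if h • y ∈ O₀ then 1 else -1) * w y := by
    intro w
    simp only [φ, LinearMap.sum_apply, LinearMap.smul_apply, LinearMap.proj_apply, smul_eq_mul]
  refine exists_bassUnit_pow_generatesNonabelianFree (permRep G X : MonoidAlgebra ℤ G →+* _)
    norm_permRep_of_le hodd ha hm hkm hk1 hk2 (bicyclicUnit (h⁻¹ * g * h) h) φ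
    (D := Fintype.card X) (by exact_mod_cast hX) ?_
    (fun y => (if y ∈ O₀ then 1 else 0) - if y ∈ (h⁻¹ * g * h) • O₀ then 1 else 0) ?_ c ?_ ?_ ?_
  · intro w
    rw [hφ]
    refine (norm_sum_le _ _).trans ((Finset.sum_le_card_nsmul _ _ ‖w‖ fun y _ => ?_).trans ?_)
    · rw [norm_mul]
      have h1 : ‖(if h • y ∈ O₀ then 1 else -1 : ℂ)‖ = 1 := by
        split_ifs <;> simp
      rw [h1, one_mul]
      exact norm_le_pi_norm w y
    · rw [Finset.card_univ, nsmul_eq_mul]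
  · intro w
    rw [hφ]
    exact permRep_bicyclicElement hfree hO₀ hO₁ hO w
  · intro i
    rw [hφ, hc]
    push_cast
    refine Finset.sum_congr rfl fun y _ => ?_
    change _ * permRep G X (MonoidAlgebra.of ℤ G (a ^ i.val)) _ y = _
    rw [permRep_of]
  · -- the functional is invariant under `g ^ h`
    simp only [hc, ZMod.val_zero, pow_zero, inv_one, one_smul, mul_sub, Finset.sum_sub_distrib]
    rw [sub_eq_zero, ← Equiv.sum_comp (MulAction.toPerm (h⁻¹ * g * h) : Equiv.Perm X)
      (fun y => (if h • y ∈ O₀ then 1 else -1 : ℤ) * if y ∈ (h⁻¹ * g * h) • O₀ then 1 else 0)]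
    refine Finset.sum_congr rfl fun y _ => ?_
    have h1 : h • (h⁻¹ * g * h) • y = g • h • y := by
      rw [← mul_smul, ← mul_smul]
      congr 1
      group
    have h2 : g • h • y ∈ O₀ ↔ h • y ∈ O₀ := by
      refine ⟨fun hy => ?_, hinv _ hO₀ g (Subgroup.mem_zpowers g) _⟩
      have := hinv _ hO₀ g⁻¹ (inv_mem (Subgroup.mem_zpowers g)) _ hy
      rwa [inv_smul_smul] at this
    simp only [MulAction.toPerm_apply, h1, h2, Set.smul_mem_smul_set_iff]
  · rw [hc, sum_coefficients_eq ha hafree (hinv _ hO₀ a hag) (hinv _ hO₁ a hag) hO]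
    intro h0
    apply hne
    have h1 := (mul_eq_zero.1 h0).resolve_left two_ne_zero
    exact_mod_cast sub_eq_zero.1 h1

end TwoOrbits

theorem theorem3 {F : Type*} [Field F] [Fintype F] (q : ℕ) (hq : Fintype.card F = q)
    (hodd : Odd q) (hq5 : q ≠ 5)
    (p : ℕ) (hp : p.Prime) (a : PSL2 F) (ha : IsDihedralCritical p a)
    (k m : ℕ) (hk : 0 < k) (hm : 0 < m) (hkm : k ^ m ≡ 1 [MOD orderOf a])
    (hu : ¬ IsOfFinOrder (bassUnit k m a hm hkm)) :
    (∃ g : PSL2 F, orderOf g = (q + 1) / 2 ∧ a ∈ Subgroup.zpowers g) ∧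
    ∀ g : PSL2 F, orderOf g = (q + 1) / 2 → a ∈ Subgroup.zpowers g →
      (cyclicOrbits (ProjLine F) g).ncard = 2 ∧
      (∀ O ∈ cyclicOrbits (ProjLine F) g, (cyclicOrbitsIn a O).ncard = (q + 1) / (2 * p)) ∧
      ∀ O₀ ∈ cyclicOrbits (ProjLine F) g, ∀ O₁ ∈ cyclicOrbits (ProjLine F) g, O₀ ≠ O₁ →
        ∀ h : PSL2 F, h ∉ dihedralizer a →
          (∑ᶠ T ∈ cyclicOrbitsIn a O₀,
              ((h • T) ∩ O₀).ncard * (T ∩ ((h⁻¹ * g * h) • O₁)).ncard) ≠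
            (∑ᶠ T ∈ cyclicOrbitsIn a O₁,
              ((h • T) ∩ O₀).ncard * (T ∩ ((h⁻¹ * g * h) • O₀)).ncard) →
          ∃ n : ℕ, 0 < n ∧
            GeneratesNonabelianFree (bassUnit k m a hm hkm ^ n)
              (bicyclicUnit (h⁻¹ * g * h) h ^ n) := by
  have hpfact : Fact p.Prime := ⟨hp⟩
  have hord := ha.orderOf_eq
  -- a Bass unit of infinite order has `k ≠ ± 1` modulo `p`, which excludes `p = 2` and `p = 3`
  have hk12 : (k : ZMod p) ≠ 1 ∧ (k : ZMod p) ≠ -1 := by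
    rw [← not_or]
    exact fun h => hu (isOfFinOrder_bassUnit hp hord hk hm hkm h)
  have hk0 : (k : ZMod p) ≠ 0 := by
    intro h0
    have h1 : ((k ^ m : ℕ) : ZMod p) = (1 : ℕ) := by
      rw [ZMod.natCast_eq_natCast_iff, ← hord]
      exact hkm
    rw [Nat.cast_pow, h0, zero_pow hm.ne', Nat.cast_one] at h1
    exact zero_ne_one h1
  have hp3 : 3 < p := by
    obtain ⟨h1, h2⟩ := hk12
    have h3 : ∀ (n : ℕ) (x : ZMod n), n = 2 ∨ n = 3 → x ≠ 0 → x ≠ 1 → x ≠ -1 → False := by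
      rintro n x (rfl | rfl) <;> revert x <;> decide
    by_contra! hle
    have h4 := hp.two_le
    exact h3 p k (by omega) hk0 h1 h2
  have hpodd : Odd p := hp.odd_of_ne_two (by omega)
  have hfix : ∀ x : ProjLine F, a • x ≠ x :=
    ha.smul_ne (by rwa [hq]) (by rwa [hq]) hp3
  have hfin : Finite (ProjLine F) := inferInstance
  have hfint : Fintype (ProjLine F) := Fintype.ofFinite _
  have hcard : Nat.card (ProjLine F) = q + 1 := by
    rw [Projectivization.card_of_finrank_two F (Fin 2 → F) (by simp), Nat.card_eq_fintype_card, hq]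
  refine ⟨by simpa only [hq] using exists_orderOf_eq_and_mem_zpowers (by rwa [hq]) hfix, ?_⟩
  intro g hg hag
  have hfree : ∀ b ∈ Subgroup.zpowers g, ∀ y : ProjLine F, b • y = y → b = 1 :=
    eq_one_of_mem_zpowers_of_smul_eq hpodd hord hag hfix
      fun b x y z hxy hxz hyz => eq_one_of_smul_eq_three hxy hxz hyz
  have hafree : ∀ b ∈ Subgroup.zpowers a, ∀ y : ProjLine F, b • y = y → b = 1 := fun b hb =>
    hfree b (Subgroup.zpowers_le.2 hag hb)
  obtain ⟨r, hr⟩ := hodd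
  have htwo : (cyclicOrbits (ProjLine F) g).ncard = 2 := by
    have h1 := ncard_cyclicOrbitsIn_mul_orderOf hfree (O := Set.univ) fun _ _ => Set.mem_univ _
    rw [cyclicOrbitsIn_univ, Set.ncard_univ, hcard, hg] at h1
    have h2 : (q + 1) = 2 * ((q + 1) / 2) := by omega
    rw [h2, Nat.mul_div_cancel_left _ two_pos] at h1
    exact Nat.eq_of_mul_eq_mul_right (by omega) h1
  refine ⟨htwo, fun O hO => ?_, ?_⟩
  · have h1 : ∀ y ∈ O, a • y ∈ O := by
      obtain ⟨z, rfl⟩ := hO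
      intro y hy
      exact MulAction.mem_orbit_of_mem_orbit (⟨a, hag⟩ : Subgroup.zpowers g) hy
    have h2 := ncard_cyclicOrbitsIn_mul_orderOf hafree h1
    rw [ncard_of_mem_cyclicOrbits hfree hO, hg, hord] at h2
    rw [← Nat.div_div_eq_div_mul, ← h2, Nat.mul_div_cancel _ hp.pos]
  · intro O₀ hO₀ O₁ hO₁ hne h _ hsum
    have horbits : ({O₀, O₁} : Set (Set (ProjLine F))) = cyclicOrbits (ProjLine F) g := by
      refine Set.eq_of_subset_of_ncard_le (Set.insert_subset hO₀ (Set.singleton_subset_iff.2 hO₁))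
        ?_
      rw [htwo, Set.ncard_pair hne]
    have horb : ∀ O ∈ cyclicOrbits (ProjLine F) g, ∀ y ∈ O,
        MulAction.orbit (Subgroup.zpowers g) y = O := by
      rintro _ ⟨z, rfl⟩ y hy
      exact MulAction.orbit_eq_iff.2 hy
    have hcompl : ∀ y, y ∈ O₁ ↔ y ∉ O₀ := by
      intro y
      refine ⟨fun h1 h0 => hne ((horb _ hO₀ y h0).symm.trans (horb _ hO₁ y h1)), fun h0 => ?_⟩
      have hmem : MulAction.orbit (Subgroup.zpowers g) y ∈ ({O₀, O₁} : Set (Set (ProjLine F))) := by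
        rw [horbits]
        exact ⟨y, rfl⟩
      rcases hmem with h1 | h1
      · exact absurd (h1 ▸ MulAction.mem_orbit_self y) h0
      · exact h1 ▸ MulAction.mem_orbit_self y
    exact exists_bassUnit_bicyclicUnit_free hpodd hord hag hfree hO₀ hO₁ hcompl hm hkm hk12.1
      hk12.2 hsum
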